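/- For $\nu\in\mathbb C$ let $J_\nu$, $Y_\nu$ be the Bessel functions of the first and second kind and $K_\nu$ the modified Bessel function of the second kind, and write p.v. for the Cauchy principal value, $$\mathrm{p.v.}\!\int_0^\infty \frac{F(t)}{t-x}\,dt=\lim_{\varepsilon\to0^+,\,R\to\infty}\Big(\int_0^{x-\varepsilon}+\int_{x+\varepsilon}^{R}\Big)\frac{F(t)}{t-x}\,dt .$$ Let $x>0$, $M>0$, $\delta<\tfrac32$, $0\le d<\omega$. Let $f$ be analytic in the open right half-plane and continuous up to the imaginary axis except possibly at the origin, where it may have a singularity (branch point) of algebraic type: $f(z)=O(|z|^{\kappa})$ as $z\to0$, $\operatorname{Re}z>0$, for some $\kappa\in\mathbb R$. Suppose that $$|f(z)|\le M|z|^{\delta}e^{d\,\operatorname{Im}z}$$ for all $z$ with $\operatorname{Re}z>0$ and $|z|$ sufficiently large. Put, for $j=1,2$, $$g_j(y)=(x+iy)e^{-\frac{\nu}{2}\pi i}f(iy)+(-1)^{j+1}(x-iy)e^{\frac{\nu}{2}\pi i}f(-iy),$$ and suppose that both integrals $\int_0^\infty \frac{K_\nu(\omega y)}{y^2+x^2}g_j(y)\,dy$,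 $j=1,2$, converge absolutely. If $f(t)J_\nu(\omega t)$ is integrable near $t=0^+$, then the following principal value exists and $$\mathrm{p.v.}\!\int_0^\infty\frac{f(t)}{t-x}J_\nu(\omega t)\,dt=-\pi f(x)Y_\nu(\omega x)-\frac1\pi\int_0^\infty\frac{K_\nu(\omega y)}{y^2+x^2}\,g_1(y)\,dy .$$ If $f(t)Y_\nu(\omega t)$ is integrable near $t=0^+$, then the following principal value exists and $$\mathrm{p.v.}\!\int_0^\infty\frac{f(t)}{t-x}Y_\nu(\omega t)\,dt=\pi f(x)J_\nu(\omega x)+\frac i\pi\int_0^\infty\frac{K_\nu(\omega y)}{y^2+x^2}\,g_2(y)\,dy .$$ -/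

import Mathlib

open MeasureTheory Filter Topology Set Complex

noncomputable section

/-- The Bessel function of the first kind of order `ν` (principal branch), through its power series
`(z/2)^ν ∑ (-1)^k / (k! Γ(ν+k+1)) (z/2)^(2k)`.  At a pole of `Γ` Mathlib's `Complex.Gamma` is `0`,
so the corresponding coefficient is `0`, which is the value of the entire function `1/Γ` there. -/
def besselJ (ν z : ℂ) : ℂ :=
  (z / 2) ^ ν *
    ∑' k : ℕ, (-1) ^ k / ((k.factorial : ℂ) * Complex.Gamma (ν + k + 1)) * (z / 2) ^ (2 * k)

/-- The Bessel function of the second kind of order `ν` (Weber's function): the limit, as `μ → ν`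
through values `μ ≠ ν`, of `(J_μ(z) cos(μπ) - J_{-μ}(z)) / sin(μπ)`.  For `ν` not an integer this is
the value of the quotient at `ν`; for an integer it is the usual limiting value. -/
def besselY (ν z : ℂ) : ℂ :=
  limUnder (𝓝[≠] ν) fun μ : ℂ =>
    (besselJ μ z * Complex.cos (μ * Real.pi) - besselJ (-μ) z) / Complex.sin (μ * Real.pi)

/-- The modified Bessel function of the second kind of order `ν`, for `0 < Re z`:
`K_ν(z) = ∫_0^∞ exp(-z cosh t) cosh(ν t) dt`. -/
def besselK (ν z : ℂ) : ℂ :=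
  ∫ t in Ioi (0 : ℝ), Complex.exp (-z * Complex.cosh t) * Complex.cosh (ν * t)

/-- `HasPVIntegral F x L`: the Cauchy principal value over `(0, ∞)` of `F`, singular at `x > 0`,
exists and equals `L`.  The integral near `0` is a Lebesgue integral, at infinity it is improper:
`L = lim (∫_0^{x-ε} F + ∫_{x+ε}^R F)` as `ε → 0+` and `R → ∞`. -/
def HasPVIntegral (F : ℝ → ℂ) (x : ℝ) (L : ℂ) : Prop :=
  (∀ ε : ℝ, 0 < ε → IntegrableOn F (Ioc 0 (x - ε)) volume) ∧
  (∀ ε R : ℝ, 0 < ε → IntegrableOn F (Ioc (x + ε) R) volume) ∧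
  Tendsto (fun p : ℝ × ℝ => (∫ t in (0 : ℝ)..(x - p.1), F t) + ∫ t in (x + p.1)..p.2, F t)
    (𝓝[>] (0 : ℝ) ×ˢ atTop) (𝓝 L)

/-- `g_j(y) = (x + iy) e^{-νπi/2} f(iy) + (-1)^{j+1} (x - iy) e^{νπi/2} f(-iy)`. -/
def besselG (j : ℕ) (ν : ℂ) (f : ℂ → ℂ) (x y : ℝ) : ℂ :=
  (x + I * y) * Complex.exp (-(ν / 2 * Real.pi * I)) * f (I * y) +
    (-1) ^ (j + 1) * (x - I * y) * Complex.exp (ν / 2 * Real.pi * I) * f (-(I * y))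

end

/-!
Write `J = (H₁ + H₂) / 2` and `Y = (H₁ - H₂) / (2 i)` with the two Hankel functions.  The function
`H₁ (ω z)` decays in the first quadrant and `H₂ (ω z)` in the fourth, faster than `f` can grow, so
the integral of `f H₁ / (z - x)` is turned to the positive imaginary axis and that of
`f H₂ / (z - x)` to the negative one, where the Hankel functions become multiples of `K`.  The pole
lies on the common side of the two quadrants and contributes half a residue to each
(`sidesIntegral_inv_sub`, `hasPVIntegral_of_rotatable`).

*The origin.*  Neither `f H₁` nor `f H₂` need be integrable near `0` on the real axis, only their
combination is, and for imaginary `ν` the zeros of `K` accumulate at `0`, so there is no useful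
bound for `f` near `0` beyond the algebraic one.  Small arcs are avoided altogether: the integrand
is multiplied by `(z / (z + η)) ^ N`, which has modulus at most `1` in the half-plane and kills the
algebraic singularity, so that Cauchy's theorem holds on rectangles with a corner at `0`
(`integral_mul_regularizer_eq_sidesIntegral`).  Then `η → 0` by dominated convergence, which needs
only the integrability of the combination on the real axis and of each part on its imaginary axis
(`integral_add_eq_sidesIntegral`).

*The Hankel functions.*  With `s = √(2 z) sinh (t / 2)` the integral for `K_ν(z)` becomes a Gaussian
integral along the ray through `(2 z) ^ (-1 / 2)`.  This continues `K_ν` to the slit plane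
(`besselKExt`), gives all bounds up to the imaginary axis (`exists_norm_besselKExt_le`) and shows
continuity in `ν`.  The link with the power series of `J` is Schläfli's integral, obtained from
Hankel's formula for `1 / Γ` by expanding an exponential (`schlaefli_loop_eq`); it yields
`K_ν = (π / 2) (I_{-ν} - I_ν) / sin (ν π)` for `z > 0` and nonintegral `ν`, hence on the slit plane
by the identity theorem.  Since both sides are continuous in `ν`, the relations between `H₁`, `H₂`, `J`
and the limit defining `Y` follow for every order.
-/

/-! ### Hankel's formula for the reciprocal Gamma function -/

/-- The substitution `u = exp t` in Euler's integral: the integrand is integrable over `ℝ`. -/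
theorem integrable_cexp_neg_exp_add {s : ℂ} (hs : 0 < s.re) :
    Integrable fun t : ℝ => cexp (-(Real.exp t : ℂ) + s * t) := by
  have h := Complex.GammaIntegral_convergent hs
  rw [← Real.range_exp, ← image_univ,
    integrableOn_image_iff_integrableOn_abs_deriv_smul MeasurableSet.univ
      (fun x _ => (Real.hasDerivAt_exp x).hasDerivWithinAt) Real.exp_injective.injOn,
    integrableOn_univ] at h
  refine h.congr (ae_of_all _ fun t => ?_)
  have ht : (Real.exp t : ℂ) ≠ 0 := by exact_mod_cast (Real.exp_pos t).ne'
  simp only [abs_of_pos (Real.exp_pos t), real_smul]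
  rw [cpow_def_of_ne_zero ht, ← ofReal_log (Real.exp_pos t).le, Real.log_exp]
  push_cast
  rw [← Complex.exp_add, ← Complex.exp_add]
  ring_nf

/-- The substitution `u = exp t` in Euler's integral for the Gamma function. -/
theorem integral_cexp_neg_exp_add {s : ℂ} (hs : 0 < s.re) :
    ∫ t : ℝ, cexp (-(Real.exp t : ℂ) + s * t) = Complex.Gamma s := by
  rw [Complex.Gamma_eq_integral hs, Complex.GammaIntegral, ← Real.range_exp, ← image_univ,
    integral_image_eq_integral_abs_deriv_smul MeasurableSet.univ
      (fun x _ => (Real.hasDerivAt_exp x).hasDerivWithinAt) Real.exp_injective.injOn,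
    setIntegral_univ]
  refine integral_congr_ae (ae_of_all _ fun t => ?_)
  have ht : (Real.exp t : ℂ) ≠ 0 := by exact_mod_cast (Real.exp_pos t).ne'
  simp only [abs_of_pos (Real.exp_pos t), real_smul]
  rw [cpow_def_of_ne_zero ht, ← ofReal_log (Real.exp_pos t).le, Real.log_exp]
  push_cast
  rw [← Complex.exp_add, ← Complex.exp_add]
  ring_nf

theorem integrableOn_hankelTail (μ : ℂ) (c : ℝ) :
    IntegrableOn (fun t : ℝ => cexp (-(Real.exp t : ℂ) - μ * t)) (Ioi c) := by
  have h := (integrable_cexp_neg_exp_add (s := ((|μ.re| + 1 : ℝ) : ℂ))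
    (by rw [ofReal_re]; positivity)).integrableOn (s := Ioi c)
  refine Integrable.mono' (h.norm.const_mul (Real.exp ((-μ.re - (|μ.re| + 1)) * c)))
    (by fun_prop) ?_
  filter_upwards [ae_restrict_mem measurableSet_Ioi] with t ht
  rw [Complex.norm_exp, Complex.norm_exp, ← Real.exp_add, Real.exp_le_exp]
  simp only [sub_re, neg_re, ofReal_re, mul_re, ofReal_im, add_re, mul_zero, sub_zero]
  have h2 : -μ.re - (|μ.re| + 1) ≤ 0 := by linarith [neg_abs_le μ.re]
  nlinarith [mul_le_mul_of_nonpos_left (le_of_lt (mem_Ioi.1 ht)) h2]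

/-- The integral of `exp (e^w - μ w)` along the loop that comes from `+∞ - iπ`, runs up the segment
from `c - iπ` to `c + iπ` and returns to `+∞ + iπ`, divided by `i`.  In the variable `e^w` this is
Hankel's contour. -/
noncomputable def hankelLoop (μ : ℂ) (c : ℝ) : ℂ :=
  (∫ θ in -Real.pi..Real.pi, cexp (cexp (c + θ * I) - μ * (c + θ * I))) -
    2 * Complex.sin (μ * Real.pi) * ∫ t in Ioi c, cexp (-(Real.exp t : ℂ) - μ * t)

theorem cexp_add_pi_mul_I (μ : ℂ) (x : ℝ) :
    cexp (cexp (x + Real.pi * I) - μ * (x + Real.pi * I)) =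
      cexp (-(Real.exp x : ℂ) - μ * x) * cexp (-(μ * Real.pi) * I) := by
  rw [Complex.exp_add, exp_pi_mul_I, ← Complex.exp_add]
  push_cast
  ring_nf

theorem cexp_sub_pi_mul_I (μ : ℂ) (x : ℝ) :
    cexp (cexp (x + (-Real.pi : ℝ) * I) - μ * (x + (-Real.pi : ℝ) * I)) =
      cexp (-(Real.exp x : ℂ) - μ * x) * cexp ((μ * Real.pi) * I) := by
  rw [Complex.exp_add]
  have : cexp (((-Real.pi : ℝ) : ℂ) * I) = -1 := by
    push_cast
    rw [neg_mul, Complex.exp_neg, exp_pi_mul_I]; norm_num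
  rw [this, ← Complex.exp_add]
  push_cast
  ring_nf

/-- By Cauchy's theorem the loop integral does not depend on the abscissa of its vertical part. -/
theorem hankelLoop_eq (μ : ℂ) (c c' : ℝ) : hankelLoop μ c = hankelLoop μ c' := by
  have h := Complex.integral_boundary_rect_eq_zero_of_differentiableOn
    (fun w => cexp (cexp w - μ * w)) (c + (-Real.pi : ℝ) * I) (c' + Real.pi * I)
    (by fun_prop)
  simp only [add_re, ofReal_re, mul_re, I_re, mul_zero, ofReal_im, I_im, mul_one, sub_self,
    add_zero, add_im, mul_im, zero_add, smul_eq_mul] at h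
  simp_rw [cexp_add_pi_mul_I, cexp_sub_pi_mul_I] at h
  rw [intervalIntegral.integral_mul_const, intervalIntegral.integral_mul_const] at h
  have hsplit : (∫ t in Ioi c, cexp (-(Real.exp t : ℂ) - μ * t)) =
      (∫ t in c..c', cexp (-(Real.exp t : ℂ) - μ * t)) +
        ∫ t in Ioi c', cexp (-(Real.exp t : ℂ) - μ * t) :=
    (intervalIntegral.integral_interval_add_Ioi
      (integrableOn_hankelTail μ c) (integrableOn_hankelTail μ c')).symm
  unfold hankelLoop
  rw [hsplit, Complex.sin]
  have hI : I * I = -1 := I_mul_I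
  linear_combination I * h + ((∫ θ in -Real.pi..Real.pi,
    cexp (cexp (c + θ * I) - μ * (c + θ * I))) -
      ∫ θ in -Real.pi..Real.pi, cexp (cexp (c' + θ * I) - μ * (c' + θ * I))) * hI

/-- For negative real part of the order the loop collapses onto the real axis, which leaves Euler's
integral. -/
theorem hankelLoop_of_re_neg {μ : ℂ} (hμ : μ.re < 0) (c : ℝ) :
    hankelLoop μ c = -2 * Complex.sin (μ * Real.pi) * Complex.Gamma (-μ) := by
  have h1 : Tendsto (fun b : ℝ => hankelLoop μ b) atBot (𝓝 (hankelLoop μ c)) := by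
    simp_rw [hankelLoop_eq μ _ c]
    exact tendsto_const_nhds
  refine tendsto_nhds_unique h1 ?_
  have hint := integrable_cexp_neg_exp_add (s := -μ) (by simpa using hμ)
  have h2 : Tendsto (fun b : ℝ => ∫ t in Ioi b, cexp (-(Real.exp t : ℂ) - μ * t)) atBot
      (𝓝 (Complex.Gamma (-μ))) := by
    rw [← integral_cexp_neg_exp_add (s := -μ) (by simpa using hμ)]
    simp_rw [sub_eq_add_neg, ← neg_mul]
    rw [← setIntegral_univ]
    have : (univ : Set ℝ) = ⋃ b : ℝᵒᵈ, Ioi (OrderDual.ofDual b) := by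
      ext y; simp only [mem_univ, mem_iUnion, mem_Ioi, true_iff]
      exact ⟨OrderDual.toDual (y - 1), by simp⟩
    rw [this]
    have h3 := tendsto_setIntegral_of_monotone (μ := volume) (ι := ℝᵒᵈ)
      (s := fun b => Ioi (OrderDual.ofDual b)) (f := fun t : ℝ => cexp (-(Real.exp t : ℂ) + -μ * t))
      (fun _ => measurableSet_Ioi) (fun a b hab => Ioi_subset_Ioi hab) hint.integrableOn
    exact h3
  have h3 : Tendsto (fun b : ℝ => ∫ θ in -Real.pi..Real.pi,
      cexp (cexp (b + θ * I) - μ * (b + θ * I))) atBot (𝓝 0) := by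
    have hlim : Tendsto (fun b : ℝ =>
        Real.exp (1 + |μ.im| * Real.pi - μ.re * b) * |Real.pi - -Real.pi|) atBot (𝓝 0) := by
      have : Tendsto (fun b : ℝ => (1 + |μ.im| * Real.pi - μ.re * b)) atBot atBot := by
        simp_rw [sub_eq_add_neg, ← neg_mul]
        exact tendsto_atBot_add_const_left _ _ (tendsto_id.const_mul_atBot (by linarith))
      simpa using (Real.tendsto_exp_atBot.comp this).mul_const (|Real.pi - -Real.pi|)
    refine squeeze_zero_norm' ?_ hlim
    filter_upwards [eventually_le_atBot 0] with b hb
    refine intervalIntegral.norm_integral_le_of_norm_le_const fun θ hθ => ?_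
    rw [uIoc_of_le (by linarith [Real.pi_pos])] at hθ
    rw [Complex.norm_exp, Real.exp_le_exp]
    have e1 : (cexp (b + θ * I)).re ≤ 1 := by
      refine (re_le_norm _).trans ?_
      rw [Complex.norm_exp]; simpa using hb
    have e2 : μ.im * θ ≤ |μ.im| * Real.pi := by
      refine (le_abs_self _).trans ?_
      rw [abs_mul]
      exact mul_le_mul_of_nonneg_left (abs_le.2 ⟨hθ.1.le, hθ.2⟩) (abs_nonneg _)
    have e3 : (μ * (b + θ * I)).re = μ.re * b - μ.im * θ := by simp
    rw [sub_re, e3]; linarith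
  have := h3.sub (h2.const_mul (2 * Complex.sin (μ * Real.pi)))
  simpa [hankelLoop] using! this

/-- Integration by parts along the loop. -/
theorem hankelLoop_sub_one (μ : ℂ) (c : ℝ) : hankelLoop (μ - 1) c = μ * hankelLoop μ c := by
  have hd1 : ∀ θ : ℝ, HasDerivAt (fun θ : ℝ => cexp (cexp (c + θ * I) - μ * (c + θ * I)))
      (I * cexp (cexp (c + θ * I) - (μ - 1) * (c + θ * I)) -
        I * μ * cexp (cexp (c + θ * I) - μ * (c + θ * I))) θ := by
    intro θ
    have h0 : HasDerivAt (fun θ : ℝ => ((c : ℂ) + θ * I)) I θ := by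
      simpa using ((ofRealCLM.hasDerivAt (x := θ)).mul_const I).const_add (c : ℂ)
    refine HasDerivAt.congr_deriv ((h0.cexp).sub (h0.const_mul μ)).cexp ?_
    have : cexp (cexp (c + θ * I) - (μ - 1) * (c + θ * I)) =
        cexp (cexp (c + θ * I) - μ * (c + θ * I)) * cexp (c + θ * I) := by
      rw [← Complex.exp_add]; ring_nf
    rw [this]; simp only [Pi.sub_apply]; ring
  have hd2 : ∀ t : ℝ, HasDerivAt (fun t : ℝ => cexp (-(Real.exp t : ℂ) - μ * t))
      (-cexp (-(Real.exp t : ℂ) - (μ - 1) * t) - μ * cexp (-(Real.exp t : ℂ) - μ * t)) t := by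
    intro t
    have h0 : HasDerivAt (fun t : ℝ => (t : ℂ)) 1 t := ofRealCLM.hasDerivAt
    have h1 : HasDerivAt (fun t : ℝ => (Real.exp t : ℂ)) (Real.exp t : ℂ) t :=
      (Real.hasDerivAt_exp t).ofReal_comp
    refine HasDerivAt.congr_deriv (h1.neg.sub (h0.const_mul μ)).cexp ?_
    have : cexp (-(Real.exp t : ℂ) - (μ - 1) * t) =
        cexp (-(Real.exp t : ℂ) - μ * t) * (Real.exp t : ℂ) := by
      rw [ofReal_exp, ← Complex.exp_add]; ring_nf
    rw [this]; simp only [Pi.sub_apply, Pi.neg_apply]; ring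
  have i1 := intervalIntegral.integral_eq_sub_of_hasDerivAt (a := -Real.pi) (b := Real.pi)
    (fun θ _ => hd1 θ) (Continuous.intervalIntegrable (by fun_prop) _ _)
  rw [intervalIntegral.integral_sub (Continuous.intervalIntegrable (by fun_prop) _ _)
    (Continuous.intervalIntegrable (by fun_prop) _ _), intervalIntegral.integral_const_mul,
    intervalIntegral.integral_const_mul, cexp_add_pi_mul_I, cexp_sub_pi_mul_I] at i1
  have n1 : IntegrableOn (fun t : ℝ => -cexp (-(Real.exp t : ℂ) - (μ - 1) * t)) (Ioi c) :=
    (integrableOn_hankelTail (μ - 1) c).neg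
  have n2 := integrableOn_hankelTail μ c
  have hlim : Tendsto (fun t : ℝ => cexp (-(Real.exp t : ℂ) - μ * t)) atTop (𝓝 0) := by
    refine tendsto_zero_of_hasDerivAt_of_integrableOn_Ioi (a := c) (fun x _ => hd2 x) ?_ n2
    exact n1.sub (n2.const_mul μ)
  have i2 := integral_Ioi_of_hasDerivAt_of_tendsto' (a := c) (fun t _ => hd2 t)
    (n1.sub (n2.const_mul μ)) hlim
  rw [integral_sub n1 (n2.const_mul μ), integral_neg, integral_const_mul] at i2
  unfold hankelLoop
  have hs : Complex.sin ((μ - 1) * Real.pi) = -Complex.sin (μ * Real.pi) := by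
    rw [sub_mul, one_mul, Complex.sin_sub_pi]
  rw [hs]
  have hsin : cexp (-(μ * Real.pi) * I) - cexp (μ * Real.pi * I) =
      -2 * I * Complex.sin (μ * Real.pi) := by
    rw [Complex.sin]
    linear_combination (cexp (-(μ * Real.pi) * I) - cexp (μ * Real.pi * I)) * I_mul_I
  have i3 : I * (∫ θ in -Real.pi..Real.pi, cexp (cexp (c + θ * I) - (μ - 1) * (c + θ * I))) -
      I * μ * (∫ θ in -Real.pi..Real.pi, cexp (cexp (c + θ * I) - μ * (c + θ * I))) =
      cexp (-(Real.exp c : ℂ) - μ * c) * (-2 * I * Complex.sin (μ * Real.pi)) := by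
    rw [i1, ← hsin]; ring
  refine mul_left_cancel₀ I_ne_zero ?_
  linear_combination i3 - 2 * I * Complex.sin (μ * Real.pi) * i2

/-- Hankel's formula for the reciprocal of the Gamma function. -/
theorem hankelLoop_eq_inv_Gamma {μ : ℂ} (hμ : ∀ n : ℤ, μ ≠ n) (c : ℝ) :
    hankelLoop μ c = 2 * Real.pi / Complex.Gamma (μ + 1) := by
  obtain ⟨n, hn⟩ := exists_nat_gt μ.re
  -- the recurrences on both sides reduce the order until its real part is negative
  induction n generalizing μ with
  | zero =>
    have hre : μ.re < 0 := by simpa using hn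
    rw [hankelLoop_of_re_neg hre]
    have h := Complex.Gamma_mul_Gamma_one_sub (-μ)
    have hG : Complex.Gamma (μ + 1) ≠ 0 := Complex.Gamma_ne_zero fun m hm =>
      hμ (-(m + 1)) (by push_cast; linear_combination hm)
    have hs : Complex.sin (μ * Real.pi) ≠ 0 := by
      rw [Complex.sin_ne_zero_iff]
      intro k hk
      exact hμ k (mul_right_cancel₀ (by exact_mod_cast Real.pi_ne_zero) hk)
    have e : Complex.sin (Real.pi * -μ) = -Complex.sin (μ * Real.pi) := by
      rw [mul_neg, Complex.sin_neg, mul_comm]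
    rw [show 1 - -μ = μ + 1 by ring, e] at h
    rw [eq_div_iff hG, mul_assoc, h]
    field_simp
  | succ n ih =>
    have h1 := ih (μ := μ - 1) (fun m hm => hμ (m + 1) (by push_cast; rw [← hm]; ring))
      (by simp only [sub_re, one_re]; push_cast at hn; linarith)
    have h0 : μ ≠ 0 := by simpa using hμ 0
    rw [hankelLoop_sub_one, sub_add_cancel] at h1
    rw [Complex.Gamma_add_one _ h0]
    rw [← div_div, div_right_comm, ← h1]
    field_simp

/-! ### Schläfli's integral -/

/-- The Bessel–Clifford function `∑ q ^ k / (k! Γ(μ + k + 1))`, entire in both arguments.  It is the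
single-valued factor of the Bessel functions: `J_μ(z) = (z / 2) ^ μ` times its value at
`-z ^ 2 / 4`. -/
noncomputable def besselClifford (μ q : ℂ) : ℂ :=
  ∑' k : ℕ, q ^ k / ((k.factorial : ℂ) * Complex.Gamma (μ + k + 1))

theorem sin_add_nat_mul_pi (μ : ℂ) (k : ℕ) :
    Complex.sin ((μ + k) * Real.pi) = (-1) ^ k * Complex.sin (μ * Real.pi) := by
  rw [add_mul]; exact Complex.sin_antiperiodic.add_nat_mul_eq k

/-- Schläfli's integral: expanding `exp (q e^{-w})` along Hankel's loop yields the Bessel–Clifford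
series. -/
theorem schlaefli_loop_eq {μ : ℂ} (hμ : ∀ n : ℤ, μ ≠ n) (q : ℂ) (c : ℝ) :
    (∫ θ in -Real.pi..Real.pi,
        cexp (cexp (c + θ * I) + q * cexp (-(c + θ * I)) - μ * (c + θ * I))) -
      2 * Complex.sin (μ * Real.pi) *
        ∫ t in Ioi c, cexp (-(Real.exp t : ℂ) - q * cexp (-t) - μ * t) =
      2 * Real.pi * besselClifford μ q := by
  have hexp : ∀ w : ℂ, HasSum (fun k : ℕ => w ^ k / (k.factorial : ℂ)) (cexp w) := fun w => by
    rw [Complex.exp_eq_exp_ℂ]; exact NormedSpace.expSeries_div_hasSum_exp w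
  have hsum : Summable fun k : ℕ => (‖q‖ * Real.exp (-c)) ^ k / (k.factorial : ℝ) :=
    Real.summable_pow_div_factorial _
  have s1 : HasSum (fun k : ℕ => ∫ θ in -Real.pi..Real.pi, q ^ k / (k.factorial : ℂ) *
      cexp (cexp (c + θ * I) - (μ + k) * (c + θ * I)))
      (∫ θ in -Real.pi..Real.pi,
        cexp (cexp (c + θ * I) + q * cexp (-(c + θ * I)) - μ * (c + θ * I))) := by
    refine intervalIntegral.hasSum_integral_of_dominated_convergence
      (fun k θ => (‖q‖ * Real.exp (-c)) ^ k / (k.factorial : ℝ) *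
        ‖cexp (cexp (c + θ * I) - μ * (c + θ * I))‖) (fun k => ?_) (fun k => ?_) ?_ ?_ ?_
    · exact Continuous.aestronglyMeasurable (by fun_prop)
    · refine ae_of_all _ fun θ _ => le_of_eq ?_
      have : cexp (cexp (c + θ * I) - (μ + k) * (c + θ * I)) =
          cexp (-(c + θ * I)) ^ k * cexp (cexp (c + θ * I) - μ * (c + θ * I)) := by
        rw [← Complex.exp_nat_mul, ← Complex.exp_add]; ring_nf
      rw [this, norm_mul, norm_mul, norm_div, norm_pow, norm_pow, Complex.norm_natCast, mul_pow,
        Complex.norm_exp (-(c + θ * I))]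
      simp only [neg_re, add_re, ofReal_re, mul_re, I_re, ofReal_im, I_im]
      ring_nf
    · exact ae_of_all _ fun θ _ => hsum.mul_right _
    · simp_rw [tsum_mul_right]
      exact Continuous.intervalIntegrable (by fun_prop) _ _
    · refine ae_of_all _ fun θ _ => ?_
      have h := (hexp (q * cexp (-(c + θ * I)))).mul_right
        (cexp (cexp (c + θ * I) - μ * (c + θ * I)))
      rw [← Complex.exp_add] at h
      convert! h using 1
      · funext k
        rw [mul_pow, ← Complex.exp_nat_mul]
        rw [div_mul_eq_mul_div, div_mul_eq_mul_div, mul_assoc, ← Complex.exp_add]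
        ring_nf
      · ring_nf
  have s2 : HasSum (fun k : ℕ => ∫ t in Ioi c, (-q) ^ k / (k.factorial : ℂ) *
      cexp (-(Real.exp t : ℂ) - (μ + k) * t))
      (∫ t in Ioi c, cexp (-(Real.exp t : ℂ) - q * cexp (-t) - μ * t)) := by
    refine hasSum_integral_of_dominated_convergence
      (fun k t => (‖q‖ * Real.exp (-c)) ^ k / (k.factorial : ℝ) *
        ‖cexp (-(Real.exp t : ℂ) - μ * t)‖) (fun k => ?_) (fun k => ?_) ?_ ?_ ?_
    · exact Continuous.aestronglyMeasurable (by fun_prop)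
    · filter_upwards [ae_restrict_mem measurableSet_Ioi] with t ht
      have : cexp (-(Real.exp t : ℂ) - (μ + k) * t) =
          cexp (-t) ^ k * cexp (-(Real.exp t : ℂ) - μ * t) := by
        rw [← Complex.exp_nat_mul, ← Complex.exp_add]; ring_nf
      rw [this, norm_mul, norm_mul, norm_div, norm_pow, norm_pow, Complex.norm_natCast, mul_pow,
        Complex.norm_exp (-t), norm_neg, ← mul_assoc, div_mul_eq_mul_div]
      have : Real.exp (-(t : ℂ)).re ≤ Real.exp (-c) := by
        simpa using (le_of_lt (mem_Ioi.1 ht))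
      gcongr
    · exact ae_of_all _ fun θ => hsum.mul_right _
    · simp_rw [tsum_mul_right]
      exact (integrableOn_hankelTail μ c).norm.const_mul _
    · refine ae_of_all _ fun t => ?_
      have h := (hexp (-q * cexp (-t))).mul_right (cexp (-(Real.exp t : ℂ) - μ * t))
      rw [← Complex.exp_add] at h
      convert! h using 1
      · funext k
        rw [mul_pow, ← Complex.exp_nat_mul]
        rw [div_mul_eq_mul_div, div_mul_eq_mul_div, mul_assoc, ← Complex.exp_add]
        ring_nf
      · ring_nf
  have s3 := s1.sub (s2.mul_left (2 * Complex.sin (μ * Real.pi)))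
  rw [← s3.tsum_eq, besselClifford, ← tsum_mul_left]
  refine tsum_congr fun k => ?_
  rw [intervalIntegral.integral_const_mul, integral_const_mul]
  have h := hankelLoop_eq_inv_Gamma (μ := μ + k)
    (fun n hn => hμ (n - k) (by push_cast; rw [← hn]; ring)) c
  rw [hankelLoop, sin_add_nat_mul_pi] at h
  rw [show 2 * (Real.pi : ℂ) * (q ^ k / ((k.factorial : ℂ) * Complex.Gamma (μ + k + 1))) =
    q ^ k / (k.factorial : ℂ) * (2 * Real.pi / Complex.Gamma (μ + k + 1)) by
      rw [← div_div]; ring, ← h]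
  have h1 : ((-1 : ℂ) ^ k) * (-1) ^ k = 1 := by rw [← mul_pow]; norm_num
  rw [neg_pow q]
  ring

/-- For positive `z` the difference of the two modified Bessel functions of the first kind is a
multiple of `K`.  Only the loops' tails survive, since the parts over the unit circle of Schläfli's
integrals for `μ` and `-μ` agree. -/
theorem besselClifford_sub_eq_besselK {μ : ℂ} (hμ : ∀ n : ℤ, μ ≠ n) {z : ℝ} (hz : 0 < z) :
    ((z : ℂ) / 2) ^ (-μ) * besselClifford (-μ) ((z : ℂ) ^ 2 / 4) -
      ((z : ℂ) / 2) ^ μ * besselClifford μ ((z : ℂ) ^ 2 / 4) =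
      2 * Complex.sin (μ * Real.pi) / Real.pi * besselK μ z := by
  have hz2 : ((z : ℂ) / 2) ≠ 0 := by
    have : (z : ℂ) ≠ 0 := by exact_mod_cast hz.ne'
    simpa using this
  set c : ℝ := Real.log (z / 2) with hc
  have hcc : cexp (c : ℂ) = (z : ℂ) / 2 := by
    rw [hc, ← ofReal_exp, Real.exp_log (by positivity)]; push_cast; ring
  have hcr : Real.exp c = z / 2 := by rw [hc, Real.exp_log (by positivity)]
  have hpow : ∀ μ : ℂ, ((z : ℂ) / 2) ^ μ = cexp (c * μ) := by
    intro μ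
    rw [cpow_def_of_ne_zero hz2, hc, ofReal_log (by positivity)]; push_cast; rfl
  have key : ∀ μ : ℂ, (∀ n : ℤ, μ ≠ n) → ((z : ℂ) / 2) ^ μ * (2 * Real.pi *
      besselClifford μ ((z : ℂ) ^ 2 / 4)) =
      (∫ θ in -Real.pi..Real.pi, cexp (z * Complex.cos θ - μ * (θ * I))) -
        2 * Complex.sin (μ * Real.pi) *
          ∫ t in Ioi (0 : ℝ), cexp (-z * Complex.cosh t - μ * t) := by
    intro μ hμ
    rw [← schlaefli_loop_eq hμ _ c, mul_sub, mul_left_comm]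
    congr 1
    · rw [← intervalIntegral.integral_const_mul]
      congr 1
      funext θ
      rw [hpow, ← Complex.exp_add]
      congr 1
      have h1 : cexp (c + θ * I) = z / 2 * cexp (θ * I) := by rw [Complex.exp_add, hcc]
      have h2 : cexp (-(c + θ * I)) = (z / 2 : ℂ)⁻¹ * cexp (-(θ * I)) := by
        rw [neg_add, Complex.exp_add, Complex.exp_neg, hcc]
      rw [h1, h2, Complex.cos, neg_mul]
      have : (z : ℂ) ≠ 0 := by exact_mod_cast hz.ne'
      field_simp
      ring
    · congr 1
      rw [← integral_const_mul]
      have := (measurePreserving_add_right (volume : Measure ℝ) c).setIntegral_preimage_emb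
        (measurableEmbedding_addRight c)
        (fun t : ℝ => ((z : ℂ) / 2) ^ μ *
          cexp (-(Real.exp t : ℂ) - (z : ℂ) ^ 2 / 4 * cexp (-t) - μ * t)) (Ioi c)
      rw [← this]
      have hpre : (fun x : ℝ => x + c) ⁻¹' Ioi c = Ioi 0 := by ext x; simp
      rw [hpre]
      refine setIntegral_congr_fun measurableSet_Ioi fun t _ => ?_
      rw [hpow, ← Complex.exp_add]
      congr 1
      have h1 : (Real.exp (t + c) : ℂ) = z / 2 * cexp t := by
        rw [Real.exp_add, hcr]; push_cast; ring
      have h2 : cexp (-((t + c : ℝ) : ℂ)) = (z / 2 : ℂ)⁻¹ * cexp (-t) := by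
        rw [ofReal_add, neg_add, Complex.exp_add, Complex.exp_neg (c : ℂ), hcc]; ring
      rw [h1, h2, Complex.cosh]
      have : (z : ℂ) ≠ 0 := by exact_mod_cast hz.ne'
      push_cast
      field_simp
      ring
  have k1 := key μ hμ
  have k2 := key (-μ) (fun n hn => hμ (-n) (by push_cast; rw [← hn]; ring))
  have hA : (∫ θ in -Real.pi..Real.pi, cexp (z * Complex.cos θ - -μ * (θ * I))) =
      ∫ θ in -Real.pi..Real.pi, cexp (z * Complex.cos θ - μ * (θ * I)) := by
    have := intervalIntegral.integral_comp_neg (a := -Real.pi) (b := Real.pi)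
      (fun θ : ℝ => cexp (z * Complex.cos θ - μ * (θ * I)))
    rw [neg_neg] at this
    rw [← this]
    congr 1
    funext θ
    push_cast
    rw [Complex.cos_neg]
    ring_nf
  have hint : ∀ μ : ℂ, IntegrableOn (fun t : ℝ => cexp (-z * Complex.cosh t - μ * t)) (Ioi 0) := by
    intro μ
    have h := (measurePreserving_add_right (volume : Measure ℝ) c).integrableOn_comp_preimage
        (measurableEmbedding_addRight c) (s := Ioi c)
        (f := fun t : ℝ => cexp (-(Real.exp t : ℂ) - μ * t))
    have hpre : (fun x : ℝ => x + c) ⁻¹' Ioi c = Ioi 0 := by ext x; simp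
    rw [hpre] at h
    have h1 := h.2 (integrableOn_hankelTail μ c)
    refine Integrable.mono' (h1.norm.const_mul (Real.exp (μ.re * c)))
      (Continuous.aestronglyMeasurable (by fun_prop)) ?_
    refine ae_of_all _ fun t => ?_
    simp only [Function.comp]
    rw [Complex.norm_exp, Complex.norm_exp, ← Real.exp_add, Real.exp_le_exp, ← ofReal_cosh,
      Real.exp_add, hcr]
    simp only [sub_re, neg_re, ofReal_re, mul_re, ofReal_im, mul_zero, sub_zero, neg_mul,
      Real.cosh_eq]
    have : 0 < z / 2 * Real.exp (-t) := by positivity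
    nlinarith
  have hB : (∫ t in Ioi (0 : ℝ), cexp (-z * Complex.cosh t - μ * t)) +
      (∫ t in Ioi (0 : ℝ), cexp (-z * Complex.cosh t - -μ * t)) = 2 * besselK μ z := by
    rw [← integral_add (hint μ) (hint (-μ)), besselK, ← integral_const_mul]
    congr 1
    funext t
    rw [Complex.cosh.eq_1 (μ * t), sub_eq_add_neg, sub_eq_add_neg, Complex.exp_add, Complex.exp_add]
    ring_nf
  rw [hA, show -μ * Real.pi = -(μ * Real.pi) by ring, Complex.sin_neg] at k2
  have hpi : (Real.pi : ℂ) ≠ 0 := by exact_mod_cast Real.pi_ne_zero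
  rw [div_mul_eq_mul_div, eq_div_iff hpi]
  linear_combination (1 / 2) * k2 - (1 / 2) * k1 + Complex.sin (μ * Real.pi) * hB

/-! ### Holomorphic dependence of integrals on a parameter -/

/-- An integral depending on a complex parameter is differentiable as soon as the integrand is
holomorphic in the parameter and locally dominated: the derivative is dominated by Cauchy's
estimate. -/
theorem differentiableAt_integral_of_dominated {α : Type*} [MeasurableSpace α] {m : Measure α}
    {F : ℂ → α → ℂ} {g : α → ℝ} {z₀ : ℂ} {r : ℝ} (hr : 0 < r)
    (hmeas : ∀ z ∈ Metric.ball z₀ r, AEStronglyMeasurable (F z) m)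
    (hdiff : ∀ᵐ a ∂m, DifferentiableOn ℂ (fun z => F z a) (Metric.ball z₀ r))
    (hbound : ∀ᵐ a ∂m, ∀ z ∈ Metric.ball z₀ r, ‖F z a‖ ≤ g a) (hg : Integrable g m) :
    DifferentiableAt ℂ (fun z => ∫ a, F z a ∂m) z₀ := by
  have hz₀ : z₀ ∈ Metric.ball z₀ r := Metric.mem_ball_self hr
  have hderiv : ∀ᵐ a ∂m, ∀ z ∈ Metric.ball z₀ r,
      HasDerivAt (fun z => F z a) (deriv (fun z => F z a) z) z := by
    filter_upwards [hdiff] with a ha z hz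
    exact (ha.differentiableAt (Metric.isOpen_ball.mem_nhds hz)).hasDerivAt
  have hF' : AEStronglyMeasurable (fun a => deriv (fun z => F z a) z₀) m := by
    obtain ⟨u, hu, hu0⟩ : ∃ u : ℕ → ℂ, (∀ n, u n ∈ Metric.ball z₀ r \ {z₀}) ∧
        Tendsto u atTop (𝓝[≠] z₀) := by
      have hmem : Metric.ball z₀ r \ {z₀} ∈ 𝓝[≠] z₀ := by
        rw [sdiff_eq, inter_comm]
        exact inter_mem_nhdsWithin _ (Metric.ball_mem_nhds z₀ hr)
      obtain ⟨u, hu⟩ := exists_seq_tendsto (𝓝[≠] z₀)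
      obtain ⟨N, hN⟩ := eventually_atTop.1 (hu.eventually hmem)
      exact ⟨fun n => u (n + N), fun n => hN _ (by lia), (tendsto_add_atTop_iff_nat N).2 hu⟩
    refine aestronglyMeasurable_of_tendsto_ae atTop
      (f := fun n a => slope (fun z => F z a) z₀ (u n)) (fun n => ?_) ?_
    · simp only [slope, vsub_eq_sub]
      exact ((hmeas _ (hu n).1).sub (hmeas _ hz₀)).const_smul (u n - z₀)⁻¹
    · filter_upwards [hderiv] with a ha
      exact (hasDerivAt_iff_tendsto_slope.1 (ha z₀ hz₀)).comp hu0
  refine (hasDerivAt_integral_of_dominated_loc_of_deriv_le (F := F)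
    (F' := fun z a => deriv (fun z => F z a) z) (bound := fun a => g a / (r / 2))
    (Metric.ball_mem_nhds z₀ (half_pos hr)) ?_ ?_ hF' ?_ (hg.div_const _) ?_).2.differentiableAt
  · filter_upwards [Metric.ball_mem_nhds z₀ hr] with z hz using hmeas z hz
  · exact hg.mono' (hmeas _ hz₀) (hbound.mono fun a ha => ha _ hz₀)
  · filter_upwards [hdiff, hbound] with a ha hb z hz
    have hsub : Metric.closedBall z (r / 2) ⊆ Metric.ball z₀ r := by
      intro w hw
      rw [Metric.mem_ball] at hz ⊢
      rw [Metric.mem_closedBall] at hw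
      linarith [dist_triangle w z z₀]
    refine Complex.norm_deriv_le_of_forall_mem_sphere_norm_le (half_pos hr) ?_
      fun w hw => hb w (hsub (Metric.sphere_subset_closedBall hw))
    exact (ha.mono ((closure_mono Metric.ball_subset_closedBall).trans
      (by rw [Metric.isClosed_closedBall.closure_eq]; exact hsub))).diffContOnCl
  · filter_upwards [hderiv] with a ha z hz
    exact ha z (Metric.ball_subset_ball (by linarith) hz)

/-! ### The analytic continuation of `K` -/

theorem re_cpow_half_pos {w : ℂ} (hw : w ∈ slitPlane) : 0 < (w ^ (1 / 2 : ℂ)).re := by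
  have h0 := slitPlane_ne_zero hw
  rw [cpow_def_of_ne_zero h0, Complex.exp_re]
  refine mul_pos (Real.exp_pos _) (Real.cos_pos_of_mem_Ioo ?_)
  have e : (Complex.log w * (1 / 2)).im = Complex.arg w / 2 := by
    rw [show (1 / 2 : ℂ) = ((1 / 2 : ℝ) : ℂ) by push_cast; ring, im_mul_ofReal, log_im]; ring
  rw [e]
  have h1 := Complex.neg_pi_lt_arg w
  have h2 := lt_of_le_of_ne (Complex.arg_le_pi w) (mem_slitPlane_iff_arg.1 hw).1
  exact ⟨by linarith, by linarith⟩

theorem cpow_half_mul_self (w : ℂ) : w ^ (1 / 2 : ℂ) * w ^ (1 / 2 : ℂ) = w := by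
  rw [← sq, one_div]
  exact_mod_cast Complex.cpow_nat_inv_pow w two_ne_zero

theorem one_add_sq_mem_slitPlane {p : ℂ} (hp : 0 < p.re) : 1 + p ^ 2 ∈ slitPlane := by
  rw [mem_slitPlane_iff]
  by_cases h : p.im = 0
  · left
    simp [sq, h]
    positivity
  · right
    have : (1 + p ^ 2).im = 2 * (p.re * p.im) := by simp [sq]; ring
    rw [this]
    simp [h, hp.ne']

/-- The inverse hyperbolic sine on the right half-plane. -/
noncomputable def carsinh (p : ℂ) : ℂ := Complex.log (p + (1 + p ^ 2) ^ (1 / 2 : ℂ))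

theorem add_cpow_half_mem_slitPlane {p : ℂ} (hp : 0 < p.re) :
    p + (1 + p ^ 2) ^ (1 / 2 : ℂ) ∈ slitPlane :=
  Or.inl (by rw [add_re]; exact add_pos hp (re_cpow_half_pos (one_add_sq_mem_slitPlane hp)))

theorem norm_cpow_half (w : ℂ) : ‖w ^ (1 / 2 : ℂ)‖ * ‖w ^ (1 / 2 : ℂ)‖ = ‖w‖ := by
  rw [← norm_mul, cpow_half_mul_self]

theorem norm_one_add_sq_cpow_half_le (p : ℂ) : ‖(1 + p ^ 2) ^ (1 / 2 : ℂ)‖ ≤ 1 + ‖p‖ := by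
  have h : ‖1 + p ^ 2‖ ≤ (1 + ‖p‖) * (1 + ‖p‖) := by
    refine (norm_add_le _ _).trans ?_
    rw [norm_one, norm_pow]; nlinarith [norm_nonneg p]
  rw [← norm_cpow_half] at h
  exact (mul_self_le_mul_self_iff (norm_nonneg _) (by positivity)).2 h

/-- The logarithmic growth of the inverse hyperbolic sine. -/
theorem norm_carsinh_le {p : ℂ} (hp : 0 < p.re) :
    ‖carsinh p‖ ≤ Real.log (1 + 2 * ‖p‖) + Real.pi := by
  set s := (1 + p ^ 2) ^ (1 / 2 : ℂ) with hs
  have hs1 := norm_one_add_sq_cpow_half_le p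
  rw [← hs] at hs1
  have hss : s * s = 1 + p ^ 2 := cpow_half_mul_self _
  have hq0 : p + s ≠ 0 := slitPlane_ne_zero (add_cpow_half_mem_slitPlane hp)
  have h1 : ‖p + s‖ ≤ 1 + 2 * ‖p‖ := (norm_add_le _ _).trans (by linarith)
  -- `p + s` and `s - p` are inverse to each other
  have h2 : ‖p + s‖⁻¹ ≤ 1 + 2 * ‖p‖ := by
    have : (p + s)⁻¹ = s - p := by
      rw [inv_eq_iff_eq_inv]; refine eq_inv_of_mul_eq_one_left ?_; linear_combination hss
    rw [← norm_inv, this]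
    exact (norm_sub_le _ _).trans (by linarith)
  have hpos : 0 < ‖p + s‖ := norm_pos_iff.2 hq0
  have h3 : |Real.log ‖p + s‖| ≤ Real.log (1 + 2 * ‖p‖) := by
    rw [abs_le]
    refine ⟨?_, Real.log_le_log hpos h1⟩
    have := Real.log_le_log (inv_pos.2 hpos) h2
    rw [Real.log_inv] at this
    linarith
  refine (norm_le_abs_re_add_abs_im _).trans (add_le_add ?_ ?_)
  · rw [carsinh, log_re]; exact h3
  · rw [carsinh, log_im]; exact abs_arg_le_pi _

/-- The kernel `cosh (2 ν arsinh p) / √(1 + p ^ 2)`. -/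
noncomputable def besselKKernel (ν p : ℂ) : ℂ :=
  Complex.cosh (2 * ν * carsinh p) / (1 + p ^ 2) ^ (1 / 2 : ℂ)

theorem norm_cosh_le (w : ℂ) : ‖Complex.cosh w‖ ≤ Real.exp ‖w‖ := by
  rw [Complex.cosh, norm_div, div_le_iff₀ (by simp)]
  refine (norm_add_le _ _).trans ?_
  have h1 := Complex.norm_exp_le_exp_norm w
  have h2 := Complex.norm_exp_le_exp_norm (-w)
  rw [norm_neg] at h2
  simp only [Complex.norm_ofNat]
  linarith

/-- In the factorization `1 + p ^ 2 = (1 + i p) (1 - i p)` each factor is at least the sine of the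
angle between `p` and the imaginary axis. -/
theorem re_div_norm_le_norm_cpow_half {p : ℂ} (hp : 0 < p.re) :
    p.re / ‖p‖ ≤ ‖(1 + p ^ 2) ^ (1 / 2 : ℂ)‖ := by
  have hp0 : 0 < ‖p‖ := norm_pos_iff.2 fun h => by simp [h] at hp
  have hn : ‖p‖ ^ 2 = p.re ^ 2 + p.im ^ 2 := by rw [Complex.sq_norm, normSq_apply]; ring
  have key : ∀ ε : ℝ, ε ^ 2 = 1 → p.re / ‖p‖ ≤ ‖1 + ε * I * p‖ := by
    intro ε hε
    rw [div_le_iff₀ hp0]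
    refine abs_le_of_sq_le_sq' ?_ (by positivity) |>.2
    have : ‖1 + ε * I * p‖ ^ 2 = (1 - ε * p.im) ^ 2 + p.re ^ 2 := by
      rw [Complex.sq_norm, normSq_apply]; simp; linear_combination (p.re ^ 2) * hε
    rw [mul_pow, this, hn]
    have e : ((1 - ε * p.im) ^ 2 + p.re ^ 2) * (p.re ^ 2 + p.im ^ 2) =
        p.re ^ 2 + (p.re ^ 2 + p.im ^ 2 - ε * p.im) ^ 2 := by
      linear_combination (p.re ^ 2 * p.im ^ 2 + p.im ^ 4 - p.im ^ 2) * hε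
    rw [e]
    linarith [sq_nonneg (p.re ^ 2 + p.im ^ 2 - ε * p.im)]
  have h1 := key 1 (by norm_num)
  have h2 := key (-1) (by norm_num)
  refine (mul_self_le_mul_self_iff (by positivity) (norm_nonneg _)).2 ?_
  rw [norm_cpow_half]
  refine (mul_le_mul h1 h2 (by positivity) (by positivity)).trans (le_of_eq ?_)
  rw [← norm_mul]; congr 1; push_cast; linear_combination (-p ^ 2) * I_mul_I

theorem norm_besselKKernel_le {ν ζ : ℂ} (hζ : 0 < ζ.re) {s : ℝ} (hs : 0 < s) :
    ‖besselKKernel ν (s * ζ)‖ ≤ ‖ζ‖ / ζ.re * Real.exp (2 * Real.pi * ‖ν‖) *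
      (1 + ‖ζ‖) ^ (2 * ‖ν‖) * Real.exp (4 * ‖ν‖ * s) := by
  have hp : 0 < ((s : ℂ) * ζ).re := by rw [re_ofReal_mul]; positivity
  have hζ0 : 0 < ‖ζ‖ := norm_pos_iff.2 fun h => by simp [h] at hζ
  have hden := re_div_norm_le_norm_cpow_half hp
  have hn : ‖(s : ℂ) * ζ‖ = s * ‖ζ‖ := by rw [norm_mul, norm_real, Real.norm_of_nonneg hs.le]
  rw [re_ofReal_mul, hn, mul_div_mul_left _ _ hs.ne'] at hden
  have hlog : Real.log (1 + 2 * (s * ‖ζ‖)) ≤ 2 * s + Real.log (1 + ‖ζ‖) := by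
    have : 1 + 2 * (s * ‖ζ‖) ≤ Real.exp (2 * s) * (1 + ‖ζ‖) := by
      have := Real.add_one_le_exp (2 * s)
      nlinarith
    refine (Real.log_le_log (by positivity) this).trans (le_of_eq ?_)
    rw [Real.log_mul (Real.exp_pos _).ne' (by positivity), Real.log_exp]
  have hars := norm_carsinh_le hp
  rw [hn] at hars
  have hcosh : ‖Complex.cosh (2 * ν * carsinh (s * ζ))‖ ≤ Real.exp (2 * Real.pi * ‖ν‖) *
      (1 + ‖ζ‖) ^ (2 * ‖ν‖) * Real.exp (4 * ‖ν‖ * s) := by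
    refine (norm_cosh_le _).trans ?_
    rw [Real.rpow_def_of_pos (by positivity), ← Real.exp_add, ← Real.exp_add, Real.exp_le_exp,
      norm_mul, norm_mul, Complex.norm_ofNat]
    nlinarith [norm_nonneg ν]
  rw [besselKKernel, norm_div, div_le_iff₀ (lt_of_lt_of_le (by positivity) hden)]
  have h1 : 1 ≤ ‖ζ‖ / ζ.re * ‖(1 + ((s : ℂ) * ζ) ^ 2) ^ (1 / 2 : ℂ)‖ := by
    calc (1 : ℝ) = ‖ζ‖ / ζ.re * (ζ.re / ‖ζ‖) := by field_simp
      _ ≤ _ := by gcongr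
  calc _ ≤ _ := hcosh
    _ ≤ _ := le_mul_of_one_le_right (by positivity) h1
    _ = _ := by ring

theorem integrable_gaussian_mul_exp (a : ℝ) :
    IntegrableOn (fun s : ℝ => Real.exp (-s ^ 2) * Real.exp (a * s)) (Ioi 0) := by
  have h : IntegrableOn (fun s : ℝ => Real.exp ((a + 1) ^ 2 / 4) * Real.exp (-s)) (Ioi 0) :=
    (integrableOn_exp_neg_Ioi 0).const_mul _
  refine h.mono' (Continuous.aestronglyMeasurable (by fun_prop)) (ae_of_all _ fun s => ?_)
  rw [Real.norm_of_nonneg (by positivity), ← Real.exp_add, ← Real.exp_add, Real.exp_le_exp]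
  nlinarith [sq_nonneg (s - (a + 1) / 2)]

theorem differentiableAt_besselKKernel (ν : ℂ) {p : ℂ} (hp : 0 < p.re) :
    DifferentiableAt ℂ (besselKKernel ν) p := by
  have h1 : DifferentiableAt ℂ (fun p : ℂ => (1 + p ^ 2) ^ (1 / 2 : ℂ)) p :=
    (by fun_prop : DifferentiableAt ℂ (fun p : ℂ => 1 + p ^ 2) p).cpow_const
      (one_add_sq_mem_slitPlane hp)
  have h2 : DifferentiableAt ℂ carsinh p :=
    (differentiableAt_id.add h1).clog (add_cpow_half_mem_slitPlane hp)
  refine DifferentiableAt.div ?_ h1 fun h => ?_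
  · exact (h2.const_mul (2 * ν)).ccosh
  · have := re_cpow_half_pos (one_add_sq_mem_slitPlane hp)
    rw [h] at this
    simp at this

theorem aestronglyMeasurable_gaussian_kernel (ν : ℂ) {ζ : ℂ} (hζ : 0 < ζ.re) :
    AEStronglyMeasurable (fun s : ℝ => (Real.exp (-s ^ 2) : ℂ) * besselKKernel ν (s * ζ))
      (volume.restrict (Ioi 0)) := by
  refine ContinuousOn.aestronglyMeasurable (fun s hs => ?_) measurableSet_Ioi
  have hp : 0 < ((s : ℂ) * ζ).re := by rw [re_ofReal_mul]; exact mul_pos hs hζ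
  refine ContinuousAt.continuousWithinAt (ContinuousAt.mul (by fun_prop) ?_)
  exact ContinuousAt.comp (f := fun s : ℝ => (s : ℂ) * ζ)
    (differentiableAt_besselKKernel ν hp).continuousAt (by fun_prop)

/-- The Gaussian integral of the kernel along the ray through `ζ`. -/
noncomputable def besselKAmplitude (ν ζ : ℂ) : ℂ :=
  ∫ s in Ioi (0 : ℝ), (Real.exp (-s ^ 2) : ℂ) * besselKKernel ν (s * ζ)

theorem norm_gaussian_kernel_le {ν ζ : ℂ} (hζ : 0 < ζ.re) {s : ℝ} (hs : 0 < s) :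
    ‖(Real.exp (-s ^ 2) : ℂ) * besselKKernel ν (s * ζ)‖ ≤
      ‖ζ‖ / ζ.re * Real.exp (2 * Real.pi * ‖ν‖) * (1 + ‖ζ‖) ^ (2 * ‖ν‖) *
        (Real.exp (-s ^ 2) * Real.exp (4 * ‖ν‖ * s)) := by
  rw [norm_mul, norm_real, Real.norm_of_nonneg (Real.exp_pos _).le]
  calc _ ≤ Real.exp (-s ^ 2) * _ :=
        mul_le_mul_of_nonneg_left (norm_besselKKernel_le hζ hs) (Real.exp_pos _).le
    _ = _ := by ring

theorem differentiableAt_besselKAmplitude (ν : ℂ) {ζ : ℂ} (hζ : 0 < ζ.re) :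
    DifferentiableAt ℂ (besselKAmplitude ν) ζ := by
  have hball : ∀ w ∈ Metric.ball ζ (ζ.re / 2), ζ.re / 2 < w.re ∧ ‖w‖ ≤ 2 * ‖ζ‖ := by
    intro w hw
    rw [Metric.mem_ball, dist_eq_norm] at hw
    have h1 := abs_re_le_norm (w - ζ)
    have h2 := re_le_norm ζ
    have h3 := norm_sub_norm_le w ζ
    rw [sub_re] at h1
    constructor
    · linarith [neg_abs_le (w.re - ζ.re)]
    · linarith
  refine differentiableAt_integral_of_dominated (r := ζ.re / 2) (half_pos hζ)
    (g := fun s => 2 * ‖ζ‖ / (ζ.re / 2) * Real.exp (2 * Real.pi * ‖ν‖) *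
      (1 + 2 * ‖ζ‖) ^ (2 * ‖ν‖) * (Real.exp (-s ^ 2) * Real.exp (4 * ‖ν‖ * s))) ?_ ?_ ?_
    ((integrable_gaussian_mul_exp _).const_mul _)
  · intro w hw
    exact aestronglyMeasurable_gaussian_kernel ν (by linarith [(hball w hw).1])
  · filter_upwards [ae_restrict_mem measurableSet_Ioi] with s hs w hw
    have hp : 0 < ((s : ℂ) * w).re := by
      rw [re_ofReal_mul]; exact mul_pos hs (by linarith [(hball w hw).1])
    refine DifferentiableAt.differentiableWithinAt (DifferentiableAt.const_mul ?_ _)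
    exact DifferentiableAt.comp (f := fun w : ℂ => (s : ℂ) * w) w
      (differentiableAt_besselKKernel ν hp) (by fun_prop)
  · filter_upwards [ae_restrict_mem measurableSet_Ioi] with s hs w hw
    obtain ⟨h1, h2⟩ := hball w hw
    refine (norm_gaussian_kernel_le (by linarith) hs).trans ?_
    gcongr

theorem continuous_besselKAmplitude {ζ : ℂ} (hζ : 0 < ζ.re) :
    Continuous fun ν => besselKAmplitude ν ζ := by
  rw [continuous_iff_continuousAt]
  intro ν₀
  refine continuousAt_of_dominated
    (bound := fun s => ‖ζ‖ / ζ.re * Real.exp (2 * Real.pi * (‖ν₀‖ + 1)) *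
      (1 + ‖ζ‖) ^ (2 * (‖ν₀‖ + 1)) * (Real.exp (-s ^ 2) * Real.exp (4 * (‖ν₀‖ + 1) * s)))
    ?_ ?_ ((integrable_gaussian_mul_exp _).const_mul _) ?_
  · exact Eventually.of_forall fun ν => aestronglyMeasurable_gaussian_kernel ν hζ
  · filter_upwards [Metric.ball_mem_nhds ν₀ one_pos] with ν hν
    filter_upwards [ae_restrict_mem measurableSet_Ioi] with s hs
    have hs' : 0 < s := hs
    have h1 : ‖ν‖ ≤ ‖ν₀‖ + 1 := by
      rw [Metric.mem_ball, dist_eq_norm] at hν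
      linarith [norm_sub_norm_le ν ν₀]
    refine (norm_gaussian_kernel_le hζ hs).trans ?_
    gcongr
    linarith [norm_nonneg ζ]
  · refine ae_of_all _ fun s => ?_
    unfold besselKKernel
    fun_prop

/-- The function `K_ν` continued analytically from the positive axis to the slit plane: with
`s = √(2 z) sinh (t / 2)` the defining integral becomes a Gaussian integral along the ray through
`(2 z) ^ (-1 / 2)`, a point of the right half-plane for every `z` off the negative axis. -/
noncomputable def besselKExt (ν z : ℂ) : ℂ :=
  2 * cexp (-z) * ((2 * z) ^ (1 / 2 : ℂ))⁻¹ * besselKAmplitude ν ((2 * z) ^ (1 / 2 : ℂ))⁻¹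

theorem two_mul_mem_slitPlane {z : ℂ} (hz : z ∈ slitPlane) : 2 * z ∈ slitPlane := by
  rw [mem_slitPlane_iff] at hz ⊢
  rcases hz with h | h
  · left; simpa using h
  · right; simpa using h

theorem re_inv_pos {w : ℂ} (hw : 0 < w.re) : 0 < (w⁻¹).re := by
  rw [inv_re]
  exact div_pos hw (normSq_pos.2 fun h => by simp [h] at hw)

theorem re_inv_two_mul_cpow_half_pos {z : ℂ} (hz : z ∈ slitPlane) :
    0 < (((2 * z) ^ (1 / 2 : ℂ))⁻¹).re :=
  re_inv_pos (re_cpow_half_pos (two_mul_mem_slitPlane hz))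

theorem differentiableOn_besselKExt (ν : ℂ) : DifferentiableOn ℂ (besselKExt ν) slitPlane := by
  intro z hz
  refine DifferentiableAt.differentiableWithinAt ?_
  have h1 : DifferentiableAt ℂ (fun z : ℂ => ((2 * z) ^ (1 / 2 : ℂ))⁻¹) z := by
    refine DifferentiableAt.inv (DifferentiableAt.cpow_const (by fun_prop)
      (two_mul_mem_slitPlane hz)) fun h => ?_
    have := re_cpow_half_pos (two_mul_mem_slitPlane hz)
    rw [h] at this
    simp at this
  refine DifferentiableAt.mul (DifferentiableAt.mul (by fun_prop) h1) ?_
  exact DifferentiableAt.comp (f := fun z : ℂ => ((2 * z) ^ (1 / 2 : ℂ))⁻¹) z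
    (differentiableAt_besselKAmplitude ν (re_inv_two_mul_cpow_half_pos hz)) h1

theorem continuous_besselKExt {z : ℂ} (hz : z ∈ slitPlane) :
    Continuous fun ν => besselKExt ν z :=
  continuous_const.mul (continuous_besselKAmplitude (re_inv_two_mul_cpow_half_pos hz))

/-- One bound covers both the exponential decay at infinity and the algebraic growth at the origin,
up to and including the imaginary axis. -/
theorem exists_norm_besselKExt_le (ν : ℂ) : ∃ C : ℝ, 0 < C ∧ ∀ z : ℂ, 0 ≤ z.re → z ≠ 0 →
    ‖besselKExt ν z‖ ≤ C * Real.exp (-z.re) * (√‖z‖)⁻¹ * (1 + (√‖z‖)⁻¹) ^ (2 * ‖ν‖) := by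
  set A := ∫ s in Ioi (0 : ℝ), Real.exp (-s ^ 2) * Real.exp (4 * ‖ν‖ * s) with hA
  have hA0 : 0 ≤ A := setIntegral_nonneg measurableSet_Ioi fun s _ => by positivity
  refine ⟨2 * (2 * Real.exp (2 * Real.pi * ‖ν‖) * (A + 1)), by positivity, fun z hz hz0 => ?_⟩
  have hslit : z ∈ slitPlane := by
    rw [mem_slitPlane_iff]
    rcases hz.lt_or_eq with h | h
    · exact Or.inl h
    · exact Or.inr fun him => hz0 (Complex.ext h.symm him)
  set w := (2 * z) ^ (1 / 2 : ℂ) with hw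
  have hwre : 0 < w.re := re_cpow_half_pos (two_mul_mem_slitPlane hslit)
  have hζ := re_inv_pos hwre
  have hww : w * w = 2 * z := cpow_half_mul_self _
  have hw0 : w ≠ 0 := fun h => by simp [h] at hwre
  have hwn : 0 < ‖w‖ := norm_pos_iff.2 hw0
  -- the square of `w` has nonnegative real part, so `w` lies in the sector `|arg w| ≤ π / 4`
  have hratio : ‖w⁻¹‖ / (w⁻¹).re ≤ 2 := by
    rw [div_le_iff₀ hζ, norm_inv, inv_re, normSq_eq_norm_sq]
    have h1 : w.re ^ 2 - w.im ^ 2 = 2 * z.re := by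
      have := congrArg Complex.re hww
      simp at this
      linarith
    have h2 : ‖w‖ ^ 2 = w.re ^ 2 + w.im ^ 2 := by rw [Complex.sq_norm, normSq_apply]; ring
    have h3 : ‖w‖ ≤ 2 * w.re := by nlinarith
    rw [mul_div_assoc', inv_eq_one_div, div_le_div_iff₀ hwn (by positivity)]
    nlinarith
  have hwz : (√‖z‖) ≤ ‖w‖ := by
    rw [Real.sqrt_le_left hwn.le, sq, ← norm_mul, hww, norm_mul, Complex.norm_ofNat]
    linarith [norm_nonneg z]
  have hzn : 0 < √‖z‖ := Real.sqrt_pos.2 (norm_pos_iff.2 hz0)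
  have hinv : ‖w⁻¹‖ ≤ (√‖z‖)⁻¹ := by rw [norm_inv]; gcongr
  have hamp : ‖besselKAmplitude ν w⁻¹‖ ≤ 2 * Real.exp (2 * Real.pi * ‖ν‖) *
      (1 + (√‖z‖)⁻¹) ^ (2 * ‖ν‖) * A := by
    rw [hA, ← integral_const_mul]
    refine norm_integral_le_of_norm_le ((integrable_gaussian_mul_exp _).const_mul _) ?_
    filter_upwards [ae_restrict_mem measurableSet_Ioi] with s hs
    refine (norm_gaussian_kernel_le hζ hs).trans ?_
    gcongr
  rw [besselKExt, ← hw, norm_mul, norm_mul, norm_mul, Complex.norm_ofNat, Complex.norm_exp, neg_re]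
  calc _ ≤ 2 * Real.exp (-z.re) * (√‖z‖)⁻¹ * (2 * Real.exp (2 * Real.pi * ‖ν‖) *
      (1 + (√‖z‖)⁻¹) ^ (2 * ‖ν‖) * (A + 1)) := by
        refine mul_le_mul (by gcongr) (hamp.trans ?_) (norm_nonneg _) (by positivity)
        gcongr
        linarith
    _ = _ := by ring

theorem carsinh_ofReal_sinh (t : ℝ) : carsinh ((Real.sinh t : ℝ) : ℂ) = t ∧
    (1 + ((Real.sinh t : ℝ) : ℂ) ^ 2) ^ (1 / 2 : ℂ) = (Real.cosh t : ℝ) := by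
  have h1 : (1 + ((Real.sinh t : ℝ) : ℂ) ^ 2) ^ (1 / 2 : ℂ) = (Real.cosh t : ℝ) := by
    have e : (1 + ((Real.sinh t : ℝ) : ℂ) ^ 2) = ((Real.cosh t ^ 2 : ℝ) : ℂ) := by
      rw [Real.cosh_sq']; push_cast; ring
    rw [e, show (1 / 2 : ℂ) = ((1 / 2 : ℝ) : ℂ) by push_cast; ring,
      ← ofReal_cpow (by positivity), ← Real.sqrt_eq_rpow, Real.sqrt_sq (Real.cosh_pos t).le]
  refine ⟨?_, h1⟩
  rw [carsinh, h1, ← ofReal_add, Real.sinh_add_cosh, ← ofReal_log (Real.exp_pos t).le,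
    Real.log_exp]

theorem besselKExt_ofReal (ν : ℂ) {z : ℝ} (hz : 0 < z) : besselKExt ν z = besselK ν z := by
  set a : ℝ := √(2 * z) with ha
  have ha0 : 0 < a := Real.sqrt_pos.2 (by positivity)
  have haa : a * a = 2 * z := Real.mul_self_sqrt (by positivity)
  have hw : (2 * (z : ℂ)) ^ (1 / 2 : ℂ) = (a : ℂ) := by
    rw [show (1 / 2 : ℂ) = ((1 / 2 : ℝ) : ℂ) by push_cast; ring,
      show (2 * (z : ℂ)) = ((2 * z : ℝ) : ℂ) by push_cast; ring,
      ← ofReal_cpow (by positivity), ← Real.sqrt_eq_rpow]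
  have himg : (fun t : ℝ => a * Real.sinh (t / 2)) '' Ioi 0 = Ioi 0 := by
    ext s
    constructor
    · rintro ⟨t, ht, rfl⟩
      exact mul_pos ha0 (Real.sinh_pos_iff.2 (half_pos ht))
    · intro hs
      refine ⟨2 * Real.arsinh (s / a), ?_, ?_⟩
      · exact mul_pos two_pos (Real.arsinh_pos_iff.2 (div_pos hs ha0))
      · simp only
        rw [mul_div_cancel_left₀ _ two_ne_zero, Real.sinh_arsinh]; field_simp
  have hder : ∀ t : ℝ, HasDerivAt (fun t : ℝ => a * Real.sinh (t / 2))
      (a * (Real.cosh (t / 2) * (1 / 2))) t := fun t =>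
    (((hasDerivAt_id t).div_const 2).sinh).const_mul a
  have hinj : InjOn (fun t : ℝ => a * Real.sinh (t / 2)) (Ioi 0) := by
    intro t _ u _ h
    have := Real.sinh_injective (mul_left_cancel₀ ha0.ne' h)
    linarith
  rw [besselKExt, hw, besselKAmplitude, ← himg, integral_image_eq_integral_abs_deriv_smul
    measurableSet_Ioi (fun t _ => (hder t).hasDerivWithinAt) hinj, besselK, ← integral_const_mul]
  refine setIntegral_congr_fun measurableSet_Ioi fun t _ => ?_
  have hc : 0 < Real.cosh (t / 2) := Real.cosh_pos _
  have hac : (a : ℂ) ≠ 0 := by exact_mod_cast ha0.ne'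
  have hcc : (Real.cosh (t / 2) : ℂ) ≠ 0 := by exact_mod_cast hc.ne'
  have hp : ((a * Real.sinh (t / 2) : ℝ) : ℂ) * (a : ℂ)⁻¹ = (Real.sinh (t / 2) : ℝ) := by
    push_cast; field_simp
  obtain ⟨e1, e2⟩ := carsinh_ofReal_sinh (t / 2)
  rw [abs_of_pos (by positivity), hp, besselKKernel, e1, e2, real_smul]
  have hexp : cexp (-(z : ℂ)) * (Real.exp (-(a * Real.sinh (t / 2)) ^ 2) : ℂ) =
      cexp (-(z : ℂ) * Complex.cosh t) := by
    rw [ofReal_exp, ← Complex.exp_add, ← ofReal_cosh]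
    congr 1
    have : Real.cosh t = 1 + 2 * Real.sinh (t / 2) ^ 2 := by
      have := Real.cosh_two_mul (t / 2)
      rw [mul_div_cancel₀ _ two_ne_zero, Real.cosh_sq'] at this
      linarith
    rw [this]
    have h : -(a * Real.sinh (t / 2)) ^ 2 = -(2 * z) * Real.sinh (t / 2) ^ 2 := by rw [← haa]; ring
    rw [h]
    push_cast
    ring
  rw [← hexp]
  have : 2 * ν * ((t / 2 : ℝ) : ℂ) = ν * t := by push_cast; ring
  rw [this]
  push_cast
  rw [ofReal_cosh] at hcc
  push_cast at hcc
  field_simp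

/-! ### The Bessel–Clifford series -/

/-- Past the first few indices the reciprocal Gamma values decrease, so they are bounded uniformly
in the index, locally uniformly in the order. -/
theorem exists_eventually_norm_inv_Gamma_le (ν₀ : ℂ) : ∃ C : ℝ, ∀ᶠ ν in 𝓝 ν₀, ∀ k : ℕ,
    ‖(Complex.Gamma (ν + k + 1))⁻¹‖ ≤ C := by
  obtain ⟨N, hN⟩ := exists_nat_ge (‖ν₀‖ + 1)
  have hcont : ∀ k : ℕ, Continuous fun ν : ℂ => ‖(Complex.Gamma (ν + k + 1))⁻¹‖ := fun k =>
    (Complex.differentiable_one_div_Gamma.continuous.comp (by fun_prop :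
      Continuous fun ν : ℂ => ν + k + 1)).norm
  set B : ℕ → ℝ := fun k => ‖(Complex.Gamma (ν₀ + k + 1))⁻¹‖ + 1 with hB
  have hB0 : ∀ k, 0 ≤ B k := fun k => by positivity
  have hev : ∀ᶠ ν in 𝓝 ν₀, ∀ k ∈ Finset.range (N + 1),
      ‖(Complex.Gamma (ν + k + 1))⁻¹‖ < B k := by
    rw [Finset.eventually_all]
    exact fun k _ => (hcont k).continuousAt.eventually_lt continuousAt_const (by simp [hB])
  refine ⟨∑ k ∈ Finset.range (N + 1), B k, ?_⟩
  filter_upwards [hev, Metric.ball_mem_nhds ν₀ one_pos] with ν h1 h2 k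
  have hle : ∀ k ≤ N, ‖(Complex.Gamma (ν + k + 1))⁻¹‖ ≤ ∑ k ∈ Finset.range (N + 1), B k :=
    fun k hk => (h1 k (by simp; lia)).le.trans
      (Finset.single_le_sum (fun i _ => hB0 i) (by simp; lia))
  rcases le_total k N with hk | hk
  · exact hle k hk
  · induction k, hk using Nat.le_induction with
    | base => exact hle N le_rfl
    | succ k hk ih =>
      have hn : 1 ≤ ‖ν + k + 1‖ := by
        rw [Metric.mem_ball, dist_eq_norm] at h2
        have h3 := norm_sub_norm_le ν ν₀
        have h4 := norm_sub_norm_le ((k : ℂ) + 1) (-ν)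
        rw [sub_neg_eq_add, norm_neg] at h4
        have h5 : ‖(k : ℂ) + 1‖ = k + 1 := by
          rw [← Nat.cast_succ, Complex.norm_natCast, Nat.cast_succ]
        have h6 : (N : ℝ) ≤ k := by exact_mod_cast hk
        rw [show ν + k + 1 = k + 1 + ν by ring]
        linarith
      have h0 : ν + k + 1 ≠ 0 := fun h => by rw [h, norm_zero] at hn; linarith
      rw [show ν + ((k + 1 : ℕ) : ℂ) + 1 = ν + k + 1 + 1 by push_cast; ring,
        Complex.Gamma_add_one _ h0, mul_inv, norm_mul, norm_inv]
      exact (mul_le_of_le_one_left (norm_nonneg _) (inv_le_one_of_one_le₀ hn)).trans ih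

theorem norm_besselClifford_term_le {ν q : ℂ} {k : ℕ} {C R : ℝ} (hq : ‖q‖ ≤ R)
    (hC : ‖(Complex.Gamma (ν + k + 1))⁻¹‖ ≤ C) :
    ‖q ^ k / ((k.factorial : ℂ) * Complex.Gamma (ν + k + 1))‖ ≤
      R ^ k / (k.factorial : ℝ) * C := by
  have hR : 0 ≤ R := (norm_nonneg _).trans hq
  rw [← div_div, div_eq_mul_inv (q ^ k / _), norm_mul, norm_div, norm_pow, Complex.norm_natCast]
  gcongr

theorem differentiable_besselClifford (ν : ℂ) : Differentiable ℂ (besselClifford ν) := by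
  intro q
  obtain ⟨C, hC⟩ := exists_eventually_norm_inv_Gamma_le ν
  have h := differentiableOn_tsum_of_summable_norm
    (F := fun (k : ℕ) (q : ℂ) => q ^ k / ((k.factorial : ℂ) * Complex.Gamma (ν + k + 1)))
    ((Real.summable_pow_div_factorial (‖q‖ + 1)).mul_right C)
    (fun k => (by fun_prop : Differentiable ℂ fun q : ℂ =>
      q ^ k / ((k.factorial : ℂ) * Complex.Gamma (ν + k + 1))).differentiableOn)
    (Metric.isOpen_ball (x := (0 : ℂ)) (ε := ‖q‖ + 1))
    (fun k w hw => norm_besselClifford_term_le (by simpa using (mem_ball_zero_iff.1 hw).le)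
      (hC.self_of_nhds k))
  exact h.differentiableAt (Metric.isOpen_ball.mem_nhds (by simp))

theorem continuous_besselClifford (q : ℂ) : Continuous fun ν => besselClifford ν q := by
  rw [continuous_iff_continuousAt]
  intro ν₀
  obtain ⟨C, hC⟩ := exists_eventually_norm_inv_Gamma_le ν₀
  refine tendsto_tsum_of_dominated_convergence
    ((Real.summable_pow_div_factorial ‖q‖).mul_right C) (fun k => ?_)
    (hC.mono fun ν hν k => norm_besselClifford_term_le le_rfl (hν k))
  have : Continuous fun ν : ℂ => (Complex.Gamma (ν + k + 1))⁻¹ :=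
    Complex.differentiable_one_div_Gamma.continuous.comp (by fun_prop)
  simp_rw [div_eq_mul_inv, mul_inv]
  exact (continuous_const.mul (continuous_const.mul this)).tendsto ν₀

theorem besselJ_eq (ν z : ℂ) : besselJ ν z = (z / 2) ^ ν * besselClifford ν (-z ^ 2 / 4) := by
  rw [besselJ, besselClifford]
  congr 1
  refine tsum_congr fun k => ?_
  rw [pow_mul, div_mul_eq_mul_div, ← mul_pow]
  congr 2
  ring

/-! ### The Hankel functions -/

theorem half_mem_slitPlane {z : ℂ} (hz : z ∈ slitPlane) : z / 2 ∈ slitPlane := by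
  rw [mem_slitPlane_iff] at hz ⊢
  rcases hz with h | h
  · left; simpa using h
  · right; simpa using h

/-- The representation of `K` by modified Bessel functions of the first kind, continued to the slit
plane. -/
theorem besselClifford_sub_eq_besselKExt {μ : ℂ} (hμ : ∀ n : ℤ, μ ≠ n) {z : ℂ}
    (hz : z ∈ slitPlane) :
    (z / 2) ^ (-μ) * besselClifford (-μ) (z ^ 2 / 4) -
      (z / 2) ^ μ * besselClifford μ (z ^ 2 / 4) =
      2 * Complex.sin (μ * Real.pi) / Real.pi * besselKExt μ z := by
  have hd : ∀ μ : ℂ, DifferentiableOn ℂ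
      (fun z : ℂ => (z / 2) ^ μ * besselClifford μ (z ^ 2 / 4)) slitPlane := fun μ z hz => by
    refine DifferentiableAt.differentiableWithinAt (DifferentiableAt.mul
      (DifferentiableAt.cpow_const (by fun_prop) (half_mem_slitPlane hz)) ?_)
    exact DifferentiableAt.comp (f := fun z : ℂ => z ^ 2 / 4) z
      (differentiable_besselClifford μ _) (by fun_prop)
  have h1 : AnalyticOnNhd ℂ (fun z : ℂ => (z / 2) ^ (-μ) * besselClifford (-μ) (z ^ 2 / 4) -
      (z / 2) ^ μ * besselClifford μ (z ^ 2 / 4)) slitPlane :=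
    ((hd (-μ)).sub (hd μ)).analyticOnNhd isOpen_slitPlane
  have h2 : AnalyticOnNhd ℂ (fun z : ℂ => 2 * Complex.sin (μ * Real.pi) / Real.pi *
      besselKExt μ z) slitPlane :=
    ((differentiableOn_besselKExt μ).const_mul _).analyticOnNhd isOpen_slitPlane
  have hconn : IsPreconnected slitPlane :=
    (starConvex_one_slitPlane.isPathConnected one_mem_slitPlane).isConnected.isPreconnected
  refine h1.eqOn_of_preconnected_of_frequently_eq h2 hconn one_mem_slitPlane ?_ hz
  have ht : Tendsto (fun x : ℝ => (x : ℂ)) (𝓝[>] 1) (𝓝[≠] 1) := by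
    refine tendsto_nhdsWithin_of_tendsto_nhds_of_eventually_within _ ?_ ?_
    · exact (continuous_ofReal.tendsto' 1 1 (by simp)).mono_left nhdsWithin_le_nhds
    · filter_upwards [self_mem_nhdsWithin] with x hx
      simpa using (ne_of_gt hx)
  refine ht.frequently (Eventually.frequently ?_)
  filter_upwards [self_mem_nhdsWithin] with x hx
  have hx0 : (0 : ℝ) < x := lt_trans one_pos hx
  rw [besselClifford_sub_eq_besselK hμ hx0, besselKExt_ofReal _ hx0]

/-- The Hankel function of the first kind, given by `K` on the half-plane to which it is rotated. -/
noncomputable def hankelOne (ν z : ℂ) : ℂ :=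
  2 / (Real.pi * I) * cexp (-(ν / 2 * Real.pi * I)) * besselKExt ν (-I * z)

/-- The Hankel function of the second kind, given by `K` on the half-plane to which it is
rotated. -/
noncomputable def hankelTwo (ν z : ℂ) : ℂ :=
  -(2 / (Real.pi * I)) * cexp (ν / 2 * Real.pi * I) * besselKExt ν (I * z)

theorem neg_I_mul_mem_slitPlane {z : ℂ} (h : z.re ≠ 0 ∨ 0 < z.im) : -I * z ∈ slitPlane := by
  rw [mem_slitPlane_iff]
  rcases h with h | h
  · right; simpa using h
  · left; simpa using h

theorem I_mul_mem_slitPlane {z : ℂ} (h : z.re ≠ 0 ∨ z.im < 0) : I * z ∈ slitPlane := by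
  rw [mem_slitPlane_iff]
  rcases h with h | h
  · right; simpa using h
  · left; simpa using h

theorem neg_I_mul_half_cpow (ν : ℂ) {t : ℝ} (ht : 0 < t) :
    (-I * t / 2) ^ ν = cexp (-(ν / 2 * Real.pi * I)) * ((t : ℂ) / 2) ^ ν := by
  have h0 : ((t : ℂ) / 2) ≠ 0 := by
    have : (t : ℂ) ≠ 0 := by exact_mod_cast ht.ne'
    simpa using this
  have h1 : Complex.log (-I * t / 2) = Complex.log (t / 2) - Real.pi / 2 * I := by
    have := Complex.log_ofReal_mul (r := t / 2) (by positivity) (x := -I) (by simp)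
    rw [Complex.log_neg_I, ofReal_log (by positivity)] at this
    push_cast at this
    rw [show -I * t / 2 = t / 2 * -I by ring, this]
    ring
  rw [cpow_def_of_ne_zero h0, cpow_def_of_ne_zero (by
    rw [mul_div_assoc]; exact mul_ne_zero (by simp) h0), h1, ← Complex.exp_add]
  ring_nf

theorem I_mul_half_cpow (ν : ℂ) {t : ℝ} (ht : 0 < t) :
    (I * t / 2) ^ ν = cexp (ν / 2 * Real.pi * I) * ((t : ℂ) / 2) ^ ν := by
  have h0 : ((t : ℂ) / 2) ≠ 0 := by
    have : (t : ℂ) ≠ 0 := by exact_mod_cast ht.ne'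
    simpa using this
  have h1 : Complex.log (I * t / 2) = Complex.log (t / 2) + Real.pi / 2 * I := by
    have := Complex.log_ofReal_mul (r := t / 2) (by positivity) (x := I) (by simp)
    rw [Complex.log_I, ofReal_log (by positivity)] at this
    push_cast at this
    rw [show I * t / 2 = t / 2 * I by ring, this]
  rw [cpow_def_of_ne_zero h0, cpow_def_of_ne_zero (by
    rw [mul_div_assoc]; exact mul_ne_zero (by simp) h0), h1, ← Complex.exp_add]
  ring_nf

/-- The Hankel functions of nonintegral order in terms of `J`, up to the factor `sin (μ π)`. -/
theorem hankel_eq_of_not_int {μ : ℂ} (hμ : ∀ n : ℤ, μ ≠ n) {t : ℝ} (ht : 0 < t) :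
    Complex.sin (μ * Real.pi) * hankelOne μ t =
        -I * (besselJ (-μ) t - cexp (-(μ * Real.pi) * I) * besselJ μ t) ∧
      Complex.sin (μ * Real.pi) * hankelTwo μ t =
        I * (besselJ (-μ) t - cexp (μ * Real.pi * I) * besselJ μ t) := by
  have hpi : (Real.pi : ℂ) ≠ 0 := by exact_mod_cast Real.pi_ne_zero
  have h1 := besselClifford_sub_eq_besselKExt hμ
    (neg_I_mul_mem_slitPlane (z := t) (Or.inl (by simpa using ht.ne')))
  have h2 := besselClifford_sub_eq_besselKExt hμ
    (I_mul_mem_slitPlane (z := t) (Or.inl (by simpa using ht.ne')))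
  have e1 : (-I * t) ^ 2 / 4 = -(t : ℂ) ^ 2 / 4 := by linear_combination (t : ℂ) ^ 2 / 4 * I_sq
  have e2 : (I * t) ^ 2 / 4 = -(t : ℂ) ^ 2 / 4 := by linear_combination (t : ℂ) ^ 2 / 4 * I_sq
  rw [neg_I_mul_half_cpow _ ht, neg_I_mul_half_cpow _ ht, e1,
    mul_assoc (cexp _) _ (besselClifford _ _), ← besselJ_eq,
    mul_assoc (cexp _) _ (besselClifford _ _), ← besselJ_eq] at h1
  rw [I_mul_half_cpow _ ht, I_mul_half_cpow _ ht, e2,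
    mul_assoc (cexp _) _ (besselClifford _ _), ← besselJ_eq,
    mul_assoc (cexp _) _ (besselClifford _ _), ← besselJ_eq] at h2
  have n1 : cexp (-(-μ / 2 * Real.pi * I)) = cexp (μ / 2 * Real.pi * I) := by ring_nf
  have n2 : cexp (-μ / 2 * Real.pi * I) = cexp (-(μ / 2 * Real.pi * I)) := by ring_nf
  rw [n1] at h1
  rw [n2] at h2
  have p0 : cexp (-(μ / 2 * Real.pi * I)) * cexp (μ / 2 * Real.pi * I) = 1 := by
    rw [← Complex.exp_add]; simp
  have p1 : cexp (-(μ * Real.pi) * I) = cexp (-(μ / 2 * Real.pi * I)) ^ 2 := by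
    rw [← Complex.exp_nat_mul]; push_cast; ring_nf
  have p2 : cexp (μ * Real.pi * I) = cexp (μ / 2 * Real.pi * I) ^ 2 := by
    rw [← Complex.exp_nat_mul]; push_cast; ring_nf
  have hI : 2 / (Real.pi * I : ℂ) = -(2 * I / Real.pi) := by
    field_simp; linear_combination I_sq
  rw [hankelOne, hankelTwo, hI, p1, p2]
  constructor
  · linear_combination I * cexp (-(μ / 2 * Real.pi * I)) * h1 -
      I * besselJ (-μ) t * p0
  · linear_combination (-I) * cexp (μ / 2 * Real.pi * I) * h2 + I * besselJ (-μ) t * p0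

theorem eventually_forall_int_ne (ν : ℂ) : ∀ᶠ μ : ℂ in 𝓝[≠] ν, ∀ n : ℤ, μ ≠ n := by
  have han : AnalyticOnNhd ℂ (fun μ : ℂ => Complex.sin (μ * Real.pi)) univ :=
    DifferentiableOn.analyticOnNhd (by fun_prop) isOpen_univ
  rcases (han ν (mem_univ _)).eventually_eq_zero_or_eventually_ne_zero with h | h
  · exfalso
    have h0 : AnalyticOnNhd ℂ (fun _ : ℂ => (0 : ℂ)) univ := fun _ _ => analyticAt_const
    have := congrFun (han.eq_of_eventuallyEq h0 h) (1 / 2)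
    rw [show (1 / 2 : ℂ) * Real.pi = Real.pi / 2 by ring, Complex.sin_pi_div_two] at this
    exact one_ne_zero this
  · filter_upwards [h] with μ hμ n hn
    exact hμ (by rw [hn, Complex.sin_int_mul_pi])

theorem sin_mul_pi_ne_zero {μ : ℂ} (hμ : ∀ n : ℤ, μ ≠ n) : Complex.sin (μ * Real.pi) ≠ 0 := by
  rw [Complex.sin_ne_zero_iff]
  intro k hk
  exact hμ k (mul_right_cancel₀ (by exact_mod_cast Real.pi_ne_zero) hk)

theorem continuous_hankelOne {t : ℝ} (ht : 0 < t) : Continuous fun ν => hankelOne ν t := by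
  have := continuous_besselKExt
    (neg_I_mul_mem_slitPlane (z := t) (Or.inl (by simpa using ht.ne')))
  unfold hankelOne
  fun_prop

theorem continuous_hankelTwo {t : ℝ} (ht : 0 < t) : Continuous fun ν => hankelTwo ν t := by
  have := continuous_besselKExt
    (I_mul_mem_slitPlane (z := t) (Or.inl (by simpa using ht.ne')))
  unfold hankelTwo
  fun_prop

theorem hankelOne_add_hankelTwo (ν : ℂ) {t : ℝ} (ht : 0 < t) :
    hankelOne ν t + hankelTwo ν t = 2 * besselJ ν t := by
  have ht2 : ((t : ℂ) / 2) ≠ 0 := by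
    have : (t : ℂ) ≠ 0 := by exact_mod_cast ht.ne'
    simpa using this
  have hc1 : Tendsto (fun μ => hankelOne μ t + hankelTwo μ t) (𝓝[≠] ν)
      (𝓝 (hankelOne ν t + hankelTwo ν t)) :=
    (((continuous_hankelOne ht).add (continuous_hankelTwo ht)).tendsto ν).mono_left
      nhdsWithin_le_nhds
  have hcJ : Continuous fun μ => 2 * besselJ μ t := by
    simp_rw [besselJ_eq]
    exact continuous_const.mul
      ((continuous_id.const_cpow (Or.inl ht2)).mul (continuous_besselClifford _))
  refine tendsto_nhds_unique hc1 (((hcJ.tendsto ν).mono_left nhdsWithin_le_nhds).congr' ?_)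
  filter_upwards [eventually_forall_int_ne ν] with μ hμ
  obtain ⟨h1, h2⟩ := hankel_eq_of_not_int hμ ht
  refine mul_left_cancel₀ (sin_mul_pi_ne_zero hμ) ?_
  have hs : Complex.sin (μ * Real.pi) =
      (cexp (-(μ * Real.pi) * I) - cexp (μ * Real.pi * I)) * I / 2 := rfl
  rw [mul_add, h1, h2, hs]
  ring

theorem hankelOne_sub_hankelTwo (ν : ℂ) {t : ℝ} (ht : 0 < t) :
    hankelOne ν t - hankelTwo ν t = 2 * I * besselY ν t := by
  have hc1 : Tendsto (fun μ => (hankelOne μ t - hankelTwo μ t) / (2 * I)) (𝓝[≠] ν)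
      (𝓝 ((hankelOne ν t - hankelTwo ν t) / (2 * I))) :=
    ((((continuous_hankelOne ht).sub (continuous_hankelTwo ht)).div_const _).tendsto ν).mono_left
      nhdsWithin_le_nhds
  have h : besselY ν t = (hankelOne ν t - hankelTwo ν t) / (2 * I) := by
    refine Tendsto.limUnder_eq (hc1.congr' ?_)
    filter_upwards [eventually_forall_int_ne ν] with μ hμ
    obtain ⟨h1, h2⟩ := hankel_eq_of_not_int hμ ht
    have hc : Complex.cos (μ * Real.pi) =
        (cexp (μ * Real.pi * I) + cexp (-(μ * Real.pi) * I)) / 2 := rfl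
    rw [eq_div_iff (sin_mul_pi_ne_zero hμ), div_mul_eq_mul_div, div_eq_iff (by simp), sub_mul,
      mul_comm (hankelOne _ _), mul_comm (hankelTwo _ _), h1, h2, hc]
    ring
  rw [h, mul_div_cancel₀ _ (by simp)]

theorem hankelOne_I_mul (ν : ℂ) {y : ℝ} (hy : 0 < y) :
    hankelOne ν (I * y) = 2 / (Real.pi * I) * cexp (-(ν / 2 * Real.pi * I)) * besselK ν y := by
  rw [hankelOne, ← mul_assoc, neg_mul, I_mul_I, neg_neg, one_mul, besselKExt_ofReal ν hy]

theorem hankelTwo_neg_I_mul (ν : ℂ) {y : ℝ} (hy : 0 < y) :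
    hankelTwo ν (-(I * y)) = -(2 / (Real.pi * I)) * cexp (ν / 2 * Real.pi * I) * besselK ν y := by
  rw [hankelTwo, mul_neg, ← mul_assoc, I_mul_I, neg_one_mul, neg_neg, besselKExt_ofReal ν hy]

theorem differentiableAt_hankelOne (ν : ℂ) {z : ℂ} (h : z.re ≠ 0 ∨ 0 < z.im) :
    DifferentiableAt ℂ (hankelOne ν) z := by
  have h1 := (differentiableOn_besselKExt ν).differentiableAt
    (isOpen_slitPlane.mem_nhds (neg_I_mul_mem_slitPlane h))
  exact (DifferentiableAt.comp (f := fun z : ℂ => -I * z) z h1 (by fun_prop)).const_mul _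

theorem differentiableAt_hankelTwo (ν : ℂ) {z : ℂ} (h : z.re ≠ 0 ∨ z.im < 0) :
    DifferentiableAt ℂ (hankelTwo ν) z := by
  have h1 := (differentiableOn_besselKExt ν).differentiableAt
    (isOpen_slitPlane.mem_nhds (I_mul_mem_slitPlane h))
  exact (DifferentiableAt.comp (f := fun z : ℂ => I * z) z h1 (by fun_prop)).const_mul _

theorem exists_norm_hankelOne_le (ν : ℂ) : ∃ C : ℝ, 0 < C ∧ ∀ z : ℂ, 0 ≤ z.im → z ≠ 0 →
    ‖hankelOne ν z‖ ≤ C * Real.exp (-z.im) * (√‖z‖)⁻¹ * (1 + (√‖z‖)⁻¹) ^ (2 * ‖ν‖) := by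
  obtain ⟨C, hC, h⟩ := exists_norm_besselKExt_le ν
  refine ⟨(‖2 / (Real.pi * I : ℂ) * cexp (-(ν / 2 * Real.pi * I))‖ + 1) * C, by positivity,
    fun z hz hz0 => ?_⟩
  have h1 := h (-I * z) (by simpa using hz) (mul_ne_zero (by simp) hz0)
  rw [show ‖-I * z‖ = ‖z‖ by simp, show (-I * z).re = z.im by simp] at h1
  rw [hankelOne, norm_mul]
  calc _ ≤ (‖2 / (Real.pi * I : ℂ) * cexp (-(ν / 2 * Real.pi * I))‖ + 1) * _ :=
        mul_le_mul (by linarith) h1 (norm_nonneg _) (by positivity)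
    _ = _ := by ring

theorem exists_norm_hankelTwo_le (ν : ℂ) : ∃ C : ℝ, 0 < C ∧ ∀ z : ℂ, z.im ≤ 0 → z ≠ 0 →
    ‖hankelTwo ν z‖ ≤ C * Real.exp z.im * (√‖z‖)⁻¹ * (1 + (√‖z‖)⁻¹) ^ (2 * ‖ν‖) := by
  obtain ⟨C, hC, h⟩ := exists_norm_besselKExt_le ν
  refine ⟨(‖-(2 / (Real.pi * I : ℂ)) * cexp (ν / 2 * Real.pi * I)‖ + 1) * C, by positivity,
    fun z hz hz0 => ?_⟩
  have h1 := h (I * z) (by simpa using hz) (mul_ne_zero (by simp) hz0)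
  rw [show ‖I * z‖ = ‖z‖ by simp, show -(I * z).re = z.im by simp] at h1
  rw [hankelTwo, norm_mul]
  calc _ ≤ (‖-(2 / (Real.pi * I : ℂ)) * cexp (ν / 2 * Real.pi * I)‖ + 1) * _ :=
        mul_le_mul (by linarith) h1 (norm_nonneg _) (by positivity)
    _ = _ := by ring

/-! ### Cauchy's theorem on a rectangle with a singular corner -/

/-- The closed first (`σ = 1`) or fourth (`σ = -1`) quadrant without the origin. -/
def puncturedQuadrant (σ : ℝ) : Set ℂ := {z | 0 ≤ z.re ∧ 0 ≤ σ * z.im ∧ z ≠ 0}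

/-- A factor of modulus at most `1` on the right half-plane that vanishes at the origin to order `N`
and tends to `1` as `η → 0`. -/
noncomputable def regularizer (N : ℕ) (η : ℝ) (z : ℂ) : ℂ := (z / (z + η)) ^ N

theorem le_norm_add_ofReal {z : ℂ} (hz : 0 ≤ z.re) (η : ℝ) : η ≤ ‖z + η‖ := by
  refine le_trans ?_ (re_le_norm _)
  rw [add_re, ofReal_re]; linarith

theorem add_ofReal_ne_zero {z : ℂ} (hz : 0 ≤ z.re) {η : ℝ} (hη : 0 < η) : z + η ≠ 0 :=
  norm_pos_iff.1 (hη.trans_le (le_norm_add_ofReal hz η))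

theorem norm_regularizer_le_one {z : ℂ} (hz : 0 ≤ z.re) {η : ℝ} (hη : 0 < η) (N : ℕ) :
    ‖regularizer N η z‖ ≤ 1 := by
  rw [regularizer, norm_pow, norm_div]
  refine pow_le_one₀ (by positivity) (div_le_one_of_le₀ ?_ (norm_nonneg _))
  refine (sq_le_sq₀ (norm_nonneg _) (norm_nonneg _)).1 ?_
  rw [Complex.sq_norm, Complex.sq_norm, normSq_apply, normSq_apply]
  simp only [add_re, ofReal_re, add_im, ofReal_im, add_zero]
  nlinarith

theorem tendsto_regularizer {z : ℂ} (hz : z ≠ 0) (N : ℕ) :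
    Tendsto (fun η => regularizer N η z) (𝓝[>] 0) (𝓝 1) := by
  have h : ContinuousAt (fun η : ℝ => (z / (z + η)) ^ N) 0 := by
    have : z + ((0 : ℝ) : ℂ) ≠ 0 := by simpa using hz
    fun_prop (disch := assumption)
  have h2 := h.tendsto
  rw [ofReal_zero, add_zero, div_self hz, one_pow] at h2
  exact h2.mono_left nhdsWithin_le_nhds

theorem differentiableAt_regularizer {z : ℂ} (hz : 0 ≤ z.re) {η : ℝ} (hη : 0 < η) (N : ℕ) :
    DifferentiableAt ℂ (regularizer N η) z := by
  have := add_ofReal_ne_zero hz hη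
  unfold regularizer
  fun_prop (disch := assumption)

theorem tendsto_integral_mul_regularizer {g γ : ℝ → ℂ} {a b : ℝ} (N : ℕ)
    (hg : IntervalIntegrable g volume a b) (hγ : Continuous γ)
    (hre : ∀ t ∈ uIoc a b, 0 ≤ (γ t).re) (hne : ∀ᵐ t, γ t ≠ 0) :
    Tendsto (fun η => ∫ t in a..b, g t * regularizer N η (γ t)) (𝓝[>] 0)
      (𝓝 (∫ t in a..b, g t)) := by
  refine intervalIntegral.tendsto_integral_filter_of_dominated_convergence (fun t => ‖g t‖)
    ?_ ?_ hg.norm ?_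
  · filter_upwards [self_mem_nhdsWithin] with η hη
    refine hg.def'.aestronglyMeasurable.mul ?_
    refine Measurable.aestronglyMeasurable ?_
    unfold regularizer
    have := hγ.measurable
    fun_prop
  · filter_upwards [self_mem_nhdsWithin] with η hη
    refine ae_of_all _ fun t ht => ?_
    rw [norm_mul]
    exact mul_le_of_le_one_right (norm_nonneg _) (norm_regularizer_le_one (hre t ht) hη N)
  · filter_upwards [hne] with t ht _
    simpa using (tendsto_regularizer ht N).const_mul (g t)

/-- The integral from `0` to `R` along the other three sides of the rectangle with corners `0` and
`R + T i`. -/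
noncomputable def sidesIntegral (E : ℂ → ℂ) (R T : ℝ) : ℂ :=
  (∫ t in (0 : ℝ)..R, E (t + T * I)) - I * (∫ y in (0 : ℝ)..T, E (R + y * I)) +
    I * ∫ y in (0 : ℝ)..T, E (y * I)

theorem sigma_mul_nonneg_of_mem_uIcc {σ R y : ℝ} (hσ : σ = 1 ∨ σ = -1) (hR : 0 ≤ R)
    (hy : y ∈ uIcc 0 (σ * R)) : 0 ≤ σ * y := by
  rcases hσ with rfl | rfl
  · rw [uIcc_of_le (by linarith)] at hy; linarith [hy.1]
  · rw [uIcc_of_ge (by linarith)] at hy; linarith [hy.2]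

/-- Cauchy's theorem on a rectangle with a corner at the origin, where a sufficiently high power of
the regularizing factor cancels the algebraic singularity. -/
theorem integral_mul_regularizer_eq_sidesIntegral {E : ℂ → ℂ} {σ R r C : ℝ} {N : ℕ}
    (hσ : σ = 1 ∨ σ = -1) (hR : 0 ≤ R) (hc : ContinuousOn E (puncturedQuadrant σ))
    (hd : DifferentiableOn ℂ E {z | 0 < z.re}) (hr : 0 < r)
    (hb : ∀ z ∈ puncturedQuadrant σ, ‖z‖ < r → ‖E z‖ * ‖z‖ ^ N ≤ C) {η : ℝ} (hη : 0 < η) :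
    (∫ t in (0 : ℝ)..R, E t * regularizer (N + 1) η t) =
      sidesIntegral (fun z => E z * regularizer (N + 1) η z) R (σ * R) := by
  have hsub : uIcc 0 R ×ℂ uIcc 0 (σ * R) ⊆ insert 0 (puncturedQuadrant σ) := by
    intro z hz
    rw [mem_reProdIm, uIcc_of_le hR] at hz
    by_cases h0 : z = 0
    · exact Or.inl h0
    · exact Or.inr ⟨hz.1.1, sigma_mul_nonneg_of_mem_uIcc hσ hR hz.2, h0⟩
  have hcont : ContinuousOn (fun z => E z * regularizer (N + 1) η z)
      (insert 0 (puncturedQuadrant σ)) := by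
    intro z hz
    rcases eq_or_ne z 0 with rfl | h0
    · have hzero : regularizer (N + 1) η 0 = 0 := by simp [regularizer]
      have hlim : Tendsto (fun z : ℂ => |C| / η ^ (N + 1) * ‖z‖)
          (𝓝[insert 0 (puncturedQuadrant σ)] 0) (𝓝 0) := by
        have : Continuous fun z : ℂ => |C| / η ^ (N + 1) * ‖z‖ := by fun_prop
        exact (this.tendsto' 0 0 (by simp)).mono_left nhdsWithin_le_nhds
      rw [ContinuousWithinAt, hzero, mul_zero]
      refine squeeze_zero_norm' ?_ hlim
      filter_upwards [self_mem_nhdsWithin, mem_nhdsWithin_of_mem_nhds (Metric.ball_mem_nhds 0 hr)]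
        with w hw hwr
      rcases hw with rfl | hw
      · simp [hzero]
      · have h1 := hb w hw (mem_ball_zero_iff.1 hwr)
        rw [regularizer, norm_mul, norm_pow, norm_div, div_pow]
        calc ‖E w‖ * (‖w‖ ^ (N + 1) / ‖w + η‖ ^ (N + 1))
            = (‖E w‖ * ‖w‖ ^ N) * ‖w‖ / ‖w + η‖ ^ (N + 1) := by ring
          _ ≤ |C| * ‖w‖ / η ^ (N + 1) := by
            gcongr
            · exact h1.trans (le_abs_self C)
            · exact le_norm_add_ofReal hw.1 η
          _ = _ := by ring
    · have hz' : z ∈ puncturedQuadrant σ := hz.resolve_left h0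
      have h1 : ContinuousWithinAt E (insert 0 (puncturedQuadrant σ)) z :=
        continuousWithinAt_insert.2 (hc z hz')
      exact h1.mul (differentiableAt_regularizer hz'.1 hη _).continuousAt.continuousWithinAt
  have h := Complex.integral_boundary_rect_eq_zero_of_continuousOn_of_differentiableOn
    (fun z => E z * regularizer (N + 1) η z) 0 (R + (σ * R : ℝ) * I)
    (hcont.mono (by simpa using hsub))
    (fun z hz => by
      rw [mem_reProdIm] at hz
      have hz1 : 0 < z.re := by simpa [hR] using hz.1.1
      refine DifferentiableAt.differentiableWithinAt (DifferentiableAt.mul ?_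
        (differentiableAt_regularizer hz1.le hη _))
      exact hd.differentiableAt ((isOpen_lt continuous_const continuous_re).mem_nhds hz1))
  simp only [zero_re, zero_im, ofReal_zero, zero_mul, add_zero, add_re, ofReal_re, mul_re, I_re,
    mul_zero, ofReal_im, I_im, mul_one, sub_self, add_im, mul_im, zero_add, smul_eq_mul] at h
  unfold sidesIntegral
  linear_combination h

theorem tendsto_sidesIntegral_regularizer {E : ℂ → ℂ} {σ R : ℝ} (N : ℕ)
    (hσ : σ = 1 ∨ σ = -1) (hR : 0 < R) (hc : ContinuousOn E (puncturedQuadrant σ))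
    (hax : IntervalIntegrable (fun y : ℝ => E (y * I)) volume 0 (σ * R)) :
    Tendsto (fun η => sidesIntegral (fun z => E z * regularizer N η z) R (σ * R)) (𝓝[>] 0)
      (𝓝 (sidesIntegral E R (σ * R))) := by
  have hσ2 : σ * σ = 1 := by rcases hσ with rfl | rfl <;> norm_num
  have hσ0 : σ ≠ 0 := by rcases hσ with rfl | rfl <;> norm_num
  have hne0 : ∀ᵐ t : ℝ, t ≠ 0 := by simp [ae_iff]
  refine ((tendsto_integral_mul_regularizer (γ := fun t : ℝ => (t : ℂ) + (σ * R : ℝ) * I) N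
    ?_ (by fun_prop) ?_ ?_).sub
    ((tendsto_integral_mul_regularizer (γ := fun y : ℝ => (R : ℂ) + y * I) N
    ?_ (by fun_prop) ?_ ?_).const_mul I)).add
    ((tendsto_integral_mul_regularizer (γ := fun y : ℝ => (y : ℂ) * I) N
    hax (by fun_prop) ?_ ?_).const_mul I)
  · refine ContinuousOn.intervalIntegrable (hc.comp (by fun_prop) fun t ht => ?_)
    rw [uIcc_of_le hR.le] at ht
    refine ⟨by simpa using ht.1, ?_, fun h => ?_⟩
    · simp [← mul_assoc, hσ2, hR.le]
    · have := congrArg Complex.im h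
      simp [hσ0, hR.ne'] at this
  · intro t ht
    rw [uIoc_of_le hR.le] at ht
    simpa using ht.1.le
  · refine ae_of_all _ fun t h => ?_
    have := congrArg Complex.im h
    simp [hσ0, hR.ne'] at this
  · refine ContinuousOn.intervalIntegrable (hc.comp (by fun_prop) fun y hy => ?_)
    refine ⟨by simpa using hR.le, ?_, fun h => ?_⟩
    · simpa using sigma_mul_nonneg_of_mem_uIcc hσ hR.le hy
    · have := congrArg Complex.re h
      simp [hR.ne'] at this
  · intro y _
    simpa using hR.le
  · refine ae_of_all _ fun t h => ?_
    have := congrArg Complex.re h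
    simp [hR.ne'] at this
  · intro y _
    simp
  · filter_upwards [hne0] with y hy
    simpa using hy

/-- Cauchy's theorem in the two quadrants at once.  On the real axis only the sum of the two
functions has to be integrable near the origin. -/
theorem integral_add_eq_sidesIntegral {E₁ E₂ : ℂ → ℂ} {R r C : ℝ} {N : ℕ} (hR : 0 < R)
    (hc₁ : ContinuousOn E₁ (puncturedQuadrant 1)) (hc₂ : ContinuousOn E₂ (puncturedQuadrant (-1)))
    (hd₁ : DifferentiableOn ℂ E₁ {z | 0 < z.re}) (hd₂ : DifferentiableOn ℂ E₂ {z | 0 < z.re})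
    (hr : 0 < r)
    (hb₁ : ∀ z ∈ puncturedQuadrant 1, ‖z‖ < r → ‖E₁ z‖ * ‖z‖ ^ N ≤ C)
    (hb₂ : ∀ z ∈ puncturedQuadrant (-1), ‖z‖ < r → ‖E₂ z‖ * ‖z‖ ^ N ≤ C)
    (hax₁ : IntervalIntegrable (fun y : ℝ => E₁ (y * I)) volume 0 (1 * R))
    (hax₂ : IntervalIntegrable (fun y : ℝ => E₂ (y * I)) volume 0 (-1 * R))
    (h : IntervalIntegrable (fun t : ℝ => E₁ t + E₂ t) volume 0 R) :
    (∫ t in (0 : ℝ)..R, E₁ t + E₂ t) =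
      sidesIntegral E₁ R (1 * R) + sidesIntegral E₂ R (-1 * R) := by
  have hne0 : ∀ᵐ t : ℝ, (t : ℂ) ≠ 0 := by simp [ae_iff]
  have l1 := tendsto_integral_mul_regularizer (γ := fun t : ℝ => (t : ℂ)) (N + 1) h (by fun_prop)
    (fun t ht => by rw [uIoc_of_le hR.le] at ht; simpa using ht.1.le) hne0
  have l2 := (tendsto_sidesIntegral_regularizer (N + 1) (Or.inl rfl) hR hc₁ hax₁).add
    (tendsto_sidesIntegral_regularizer (N + 1) (Or.inr rfl) hR hc₂ hax₂)
  refine tendsto_nhds_unique l1 (l2.congr' ?_)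
  filter_upwards [self_mem_nhdsWithin] with η hη
  have hint : ∀ {E : ℂ → ℂ} {σ : ℝ}, ContinuousOn E (puncturedQuadrant σ) →
      (∀ z ∈ puncturedQuadrant σ, ‖z‖ < r → ‖E z‖ * ‖z‖ ^ N ≤ C) →
      IntervalIntegrable (fun t : ℝ => E t * regularizer (N + 1) η t) volume 0 R := by
    intro E σ hc hb
    have hmem : ∀ t : ℝ, 0 < t → (t : ℂ) ∈ puncturedQuadrant σ := fun t ht =>
      ⟨by simpa using ht.le, by simp, by simpa using ht.ne'⟩
    have hcont : ContinuousOn (fun t : ℝ => E t * regularizer (N + 1) η t) (Ioi 0) := by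
      refine ContinuousOn.mul (hc.comp (by fun_prop) fun t ht => hmem t ht) fun t ht => ?_
      exact (ContinuousAt.comp (f := fun t : ℝ => (t : ℂ))
        (differentiableAt_regularizer (by simpa using (le_of_lt ht)) hη _).continuousAt
        (by fun_prop)).continuousWithinAt
    have hr2 : 0 < min (r / 2) R := lt_min (half_pos hr) hR
    refine IntervalIntegrable.trans (b := min (r / 2) R) ?_ ?_
    · rw [intervalIntegrable_iff_integrableOn_Ioc_of_le hr2.le]
      refine ⟨(hcont.mono fun t ht => ht.1).aestronglyMeasurable measurableSet_Ioc,
        .restrict_of_bounded (C := |C| * r / η ^ (N + 1)) (by simp) ?_⟩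
      filter_upwards [ae_restrict_mem measurableSet_Ioc] with t ht
      have htr : ‖(t : ℂ)‖ < r := by
        rw [norm_real, Real.norm_of_nonneg ht.1.le]
        linarith [ht.2.trans (min_le_left (r / 2) R)]
      have h1 := hb t (hmem t ht.1) htr
      rw [regularizer, norm_mul, norm_pow, norm_div, div_pow]
      calc ‖E t‖ * (‖(t : ℂ)‖ ^ (N + 1) / ‖(t : ℂ) + η‖ ^ (N + 1))
          = (‖E t‖ * ‖(t : ℂ)‖ ^ N) * ‖(t : ℂ)‖ / ‖(t : ℂ) + η‖ ^ (N + 1) := by ring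
        _ ≤ |C| * r / η ^ (N + 1) := by
          have hη' : (0 : ℝ) < η := hη
          gcongr
          · exact h1.trans (le_abs_self C)
          · exact le_norm_add_ofReal (by simpa using ht.1.le) η
    · refine ContinuousOn.intervalIntegrable (hcont.mono fun t ht => ?_)
      rw [uIcc_of_le (min_le_right _ _)] at ht
      exact hr2.trans_le ht.1
  rw [← integral_mul_regularizer_eq_sidesIntegral (Or.inl rfl) hR.le hc₁ hd₁ hr hb₁ hη,
    ← integral_mul_regularizer_eq_sidesIntegral (Or.inr rfl) hR.le hc₂ hd₂ hr hb₂ hη,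
    ← intervalIntegral.integral_add (hint hc₁ hb₁) (hint hc₂ hb₂)]
  simp_rw [add_mul]

/-! ### The contribution of the pole -/

/-- The pole contributes half a residue and a logarithm, which cancels against the principal value
of the integral along the real side. -/
theorem sidesIntegral_inv_sub {σ R x : ℝ} (hσ : σ = 1 ∨ σ = -1) (hx : 0 < x) (hR : x < R) :
    sidesIntegral (fun z => (z - x)⁻¹) R (σ * R) =
      Real.log ((R - x) / x) - σ * Real.pi * I := by
  have hσ2 : σ * σ = 1 := by rcases hσ with rfl | rfl <;> norm_num
  have hσ0 : σ ≠ 0 := by rcases hσ with rfl | rfl <;> norm_num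
  have hR0 : 0 < R := hx.trans hR
  -- a branch of `log (z - x)` whose cut avoids the closed quadrant
  set L : ℂ → ℂ := fun z => Complex.log (-(σ : ℂ) * I * (z - x)) with hL
  have hder : ∀ {γ : ℝ → ℂ} {γ' : ℂ} {t : ℝ}, HasDerivAt γ γ' t →
      (0 < σ * (γ t).im ∨ (γ t).re ≠ x) →
      HasDerivAt (fun t => L (γ t)) (γ' * (γ t - x)⁻¹) t := by
    intro γ γ' t hγ h
    have hs : -(σ : ℂ) * I * (γ t - x) ∈ slitPlane := by
      rw [mem_slitPlane_iff]
      rcases h with h | h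
      · left; simpa using h
      · right; simpa [hσ0, sub_eq_zero] using h
    have h1 : HasDerivAt (fun t => -(σ : ℂ) * I * (γ t - x)) (-(σ : ℂ) * I * γ') t :=
      (hγ.sub_const _).const_mul _
    convert h1.clog_real hs using 1
    have hc : -(σ : ℂ) * I ≠ 0 := by simp [hσ0]
    have hz : γ t - x ≠ 0 := right_ne_zero_of_mul (slitPlane_ne_zero hs)
    have hσc : (σ : ℂ) ≠ 0 := by exact_mod_cast hσ0
    field_simp
  have hpos : 0 < σ * (σ * R) := by rw [← mul_assoc, hσ2, one_mul]; exact hR0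
  have htop : (∫ t in (0 : ℝ)..R, ((t : ℂ) + (σ * R : ℝ) * I - x)⁻¹) =
      L (R + (σ * R : ℝ) * I) - L ((0 : ℝ) + (σ * R : ℝ) * I) := by
    have hd : ∀ t ∈ uIcc 0 R, HasDerivAt (fun t : ℝ => L ((t : ℂ) + (σ * R : ℝ) * I))
        (1 * ((t : ℂ) + (σ * R : ℝ) * I - x)⁻¹) t := fun t _ =>
      hder (γ := fun t : ℝ => (t : ℂ) + (σ * R : ℝ) * I)
        ((ofRealCLM.hasDerivAt (x := t)).add_const _) (Or.inl (by simpa using hpos))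
    simp_rw [one_mul] at hd
    refine intervalIntegral.integral_eq_sub_of_hasDerivAt hd ?_
    refine ContinuousOn.intervalIntegrable (ContinuousOn.inv₀ (by fun_prop) fun t _ h => ?_)
    have := congrArg Complex.im h
    simp [hσ0, hR0.ne'] at this
  have hvert : ∀ c : ℝ, c ≠ x → I * (∫ y in (0 : ℝ)..(σ * R), ((c : ℂ) + y * I - x)⁻¹) =
      L (c + (σ * R : ℝ) * I) - L (c + (0 : ℝ) * I) := by
    intro c hc
    have hd : ∀ y ∈ uIcc 0 (σ * R), HasDerivAt (fun y : ℝ => L ((c : ℂ) + y * I))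
        (I * ((c : ℂ) + y * I - x)⁻¹) y := fun y _ =>
      hder (γ := fun y : ℝ => (c : ℂ) + y * I)
        (by simpa using ((ofRealCLM.hasDerivAt (x := y)).mul_const I).const_add (c : ℂ))
        (Or.inr (by simpa using hc))
    rw [← intervalIntegral.integral_const_mul]
    refine intervalIntegral.integral_eq_sub_of_hasDerivAt hd ?_
    refine ContinuousOn.intervalIntegrable (continuousOn_const.mul
      (ContinuousOn.inv₀ (by fun_prop) fun t _ h => ?_))
    have := congrArg Complex.re h
    simp [sub_eq_zero, hc] at this
  have h0 := hvert 0 hx.ne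
  simp only [ofReal_zero, zero_add] at h0 htop
  rw [sidesIntegral, htop, hvert R hR.ne', h0]
  have hσI : Complex.log (-(σ : ℂ) * I) = -(σ * (Real.pi / 2) * I) ∧
      Complex.log ((σ : ℂ) * I) = σ * (Real.pi / 2) * I := by
    rcases hσ with rfl | rfl
    · simp [Complex.log_I, Complex.log_neg_I]
    · simp [Complex.log_I, Complex.log_neg_I]
  have e1 : L (R + (0 : ℂ) * I) = Real.log (R - x) - σ * (Real.pi / 2) * I := by
    have := Complex.log_ofReal_mul (r := R - x) (by linarith) (x := -(σ : ℂ) * I)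
      (by simp [hσ0])
    rw [hσI.1] at this
    simp only [hL, zero_mul, add_zero]
    rw [mul_comm, ← ofReal_sub, this]
    ring
  have e2 : L ((0 : ℂ) * I) = Real.log x + σ * (Real.pi / 2) * I := by
    have := Complex.log_ofReal_mul (r := x) hx (x := (σ : ℂ) * I) (by simp [hσ0])
    rw [hσI.2] at this
    simp only [hL, zero_mul, zero_sub]
    rw [← this]
    ring_nf
  simp only [ofReal_zero]
  rw [e1, e2, Real.log_div (by linarith) hx.ne', ofReal_sub]
  ring

/-! ### Rotation of the contour in one quadrant -/

/-- The conditions on a function `G` under which the integral of `G z / (z - x)` along the positive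
real axis can be turned to the upper (`σ = 1`) or lower (`σ = -1`) imaginary axis, apart from its
integrability near the origin of the real axis. -/
structure RotatableOnQuadrant (σ x : ℝ) (N : ℕ) (G : ℂ → ℂ) : Prop where
  continuousOn : ContinuousOn G (puncturedQuadrant σ)
  differentiableOn : DifferentiableOn ℂ G {z | 0 < z.re}
  bound_zero : ∃ C r : ℝ, 0 < r ∧ ∀ z ∈ puncturedQuadrant σ, ‖z‖ < r → ‖G z‖ * ‖z‖ ^ N ≤ C
  bound_infty : ∃ a s C R₀ : ℝ, 0 < a ∧ s < 1 ∧ ∀ z : ℂ, 0 < z.re → 0 ≤ σ * z.im → R₀ ≤ ‖z‖ →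
    ‖G z‖ ≤ C * ‖z‖ ^ s * Real.exp (-(a * (σ * z.im)))
  integrableOn_axis :
    IntegrableOn (fun y : ℝ => G ((σ * y : ℝ) * I) / ((σ * y : ℝ) * I - x)) (Ioi 0)

/-- The contribution of the sides of the square that recede to infinity.  The decay off the real
axis makes up for the length of the sides, so that any negative power of the size suffices. -/
theorem tendsto_far_sides {G : ℂ → ℂ} {σ x a s C R₀ : ℝ} (hσ : σ = 1 ∨ σ = -1) (ha : 0 < a)
    (hs : s < 1) (hx : 0 < x) (hG : ∀ z : ℂ, 0 < z.re → 0 ≤ σ * z.im → R₀ ≤ ‖z‖ →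
      ‖G z‖ ≤ C * ‖z‖ ^ s * Real.exp (-(a * (σ * z.im)))) :
    Tendsto (fun R : ℝ => (∫ t in (0 : ℝ)..R,
        G (t + (σ * R : ℝ) * I) / (t + (σ * R : ℝ) * I - x)) -
      I * ∫ y in (0 : ℝ)..(σ * R), G (R + y * I) / (R + y * I - x)) atTop (𝓝 0) := by
  have hσ2 : σ * σ = 1 := by rcases hσ with rfl | rfl <;> norm_num
  have hσn : ‖(σ : ℂ)‖ = 1 := by rcases hσ with rfl | rfl <;> simp
  have hpt : ∀ R : ℝ, max R₀ (2 * x) ≤ R → ∀ z : ℂ, 0 < z.re → 0 ≤ σ * z.im → R ≤ ‖z‖ →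
      ‖G z / (z - x)‖ ≤ 2 * |C| * R ^ (s - 1) * Real.exp (-(a * (σ * z.im))) := by
    intro R hR z hz1 hz2 hz3
    have hR1 : R₀ ≤ R := (le_max_left _ _).trans hR
    have hR2 : 2 * x ≤ R := (le_max_right _ _).trans hR
    have hR0 : 0 < R := by linarith
    have hz0 : 0 < ‖z‖ := by linarith
    have hzx : ‖z‖ / 2 ≤ ‖z - x‖ := by
      have := norm_sub_norm_le z (x : ℂ)
      rw [norm_real, Real.norm_of_nonneg hx.le] at this
      linarith
    rw [norm_div, div_le_iff₀ (by linarith)]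
    have h1 : ‖z‖ ^ (s - 1) ≤ R ^ (s - 1) :=
      Real.rpow_le_rpow_of_nonpos (by linarith) hz3 (by linarith)
    calc ‖G z‖ ≤ C * ‖z‖ ^ s * Real.exp (-(a * (σ * z.im))) := hG z hz1 hz2 (hR1.trans hz3)
      _ ≤ |C| * ‖z‖ ^ s * Real.exp (-(a * (σ * z.im))) := by gcongr; exact le_abs_self C
      _ = 2 * |C| * ‖z‖ ^ (s - 1) * Real.exp (-(a * (σ * z.im))) * (‖z‖ / 2) := by
        rw [Real.rpow_sub_one hz0.ne']; field_simp
      _ ≤ 2 * |C| * R ^ (s - 1) * Real.exp (-(a * (σ * z.im))) * ‖z - x‖ := by gcongr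
  have hlim : Tendsto (fun R : ℝ => 4 * |C| / a * R ^ (s - 1)) atTop (𝓝 0) := by
    have := (tendsto_rpow_neg_atTop (y := 1 - s) (by linarith)).const_mul (4 * |C| / a)
    rw [mul_zero, neg_sub] at this
    exact this
  refine squeeze_zero_norm' ?_ hlim
  filter_upwards [eventually_ge_atTop (max R₀ (2 * x))] with R hR
  have hR0 : 0 < R := by linarith [(le_max_right _ _).trans hR]
  have h1 : ‖∫ t in (0 : ℝ)..R, G (t + (σ * R : ℝ) * I) / (t + (σ * R : ℝ) * I - x)‖ ≤
      2 * |C| / a * R ^ (s - 1) := by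
    have h2 : ‖∫ t in (0 : ℝ)..R, G (t + (σ * R : ℝ) * I) / (t + (σ * R : ℝ) * I - x)‖ ≤
        2 * |C| * R ^ (s - 1) * Real.exp (-(a * R)) * |R - 0| := by
      refine intervalIntegral.norm_integral_le_of_norm_le_const fun t ht => ?_
      rw [uIoc_of_le hR0.le] at ht
      have him : σ * ((t : ℂ) + (σ * R : ℝ) * I).im = R := by
        simp [← mul_assoc, hσ2]
      have h := hpt R hR (t + (σ * R : ℝ) * I) (by simpa using ht.1) (by rw [him]; exact hR0.le) ?_
      · rwa [him] at h
      · have h3 := abs_im_le_norm ((t : ℂ) + (σ * R : ℝ) * I)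
        refine le_trans ?_ h3
        have : |((t : ℂ) + (σ * R : ℝ) * I).im| = |R| := by
          rcases hσ with rfl | rfl <;> simp
        rw [this]
        exact le_abs_self R
    refine h2.trans ?_
    have h3 : Real.exp (-(a * R)) * R ≤ 1 / a := by
      rw [Real.exp_neg, le_div_iff₀ ha, inv_mul_eq_div, div_mul_eq_mul_div,
        div_le_one (Real.exp_pos _)]
      linarith [Real.add_one_le_exp (a * R)]
    rw [sub_zero, abs_of_pos hR0]
    calc 2 * |C| * R ^ (s - 1) * Real.exp (-(a * R)) * R
        = 2 * |C| * R ^ (s - 1) * (Real.exp (-(a * R)) * R) := by ring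
      _ ≤ 2 * |C| * R ^ (s - 1) * (1 / a) := by gcongr
      _ = _ := by ring
  have h2 : ‖∫ y in (0 : ℝ)..(σ * R), G (R + y * I) / (R + y * I - x)‖ ≤
      2 * |C| / a * R ^ (s - 1) := by
    have e' : (∫ y in (0 : ℝ)..(σ * R), G (R + y * I) / (R + y * I - x)) =
        σ • ∫ y in (0 : ℝ)..R, G (R + (σ * y : ℝ) * I) / (R + (σ * y : ℝ) * I - x) := by
      rw [intervalIntegral.smul_integral_comp_mul_left
        (fun y : ℝ => G (R + y * I) / (R + y * I - x)) σ, mul_zero]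
    have hexp : (∫ u in (0 : ℝ)..R, Real.exp (-(a * u))) ≤ 1 / a := by
      have := intervalIntegral.integral_comp_mul_left (a := 0) (b := R) Real.exp
        (c := -a) (by linarith)
      simp only [neg_mul] at this
      rw [this, integral_exp, smul_eq_mul, mul_zero, neg_zero, Real.exp_zero,
        inv_neg, neg_mul, ← mul_neg, neg_sub, inv_mul_eq_div]
      gcongr
      linarith [Real.exp_pos (-(a * R))]
    rw [e', real_smul, norm_mul, hσn, one_mul]
    refine (intervalIntegral.norm_integral_le_of_norm_le hR0.le
      (g := fun u => 2 * |C| * R ^ (s - 1) * Real.exp (-(a * u))) ?_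
      (Continuous.intervalIntegrable (by fun_prop) _ _)).trans ?_
    · refine ae_of_all _ fun u hu => ?_
      have him : σ * ((R : ℂ) + (σ * u : ℝ) * I).im = u := by
        simp [← mul_assoc, hσ2]
      have h := hpt R hR (R + (σ * u : ℝ) * I) (by simpa using hR0) (by rw [him]; exact hu.1.le) ?_
      · rwa [him] at h
      · refine le_trans ?_ (re_le_norm _)
        simp
    · rw [intervalIntegral.integral_const_mul]
      calc _ ≤ 2 * |C| * R ^ (s - 1) * (1 / a) := by gcongr
        _ = _ := by ring
  refine (norm_sub_le _ _).trans ?_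
  rw [norm_mul, norm_I, one_mul]
  calc _ ≤ 2 * |C| / a * R ^ (s - 1) + 2 * |C| / a * R ^ (s - 1) := add_le_add h1 h2
    _ = _ := by ring

theorem sidesIntegral_sub_const_mul {E F : ℂ → ℂ} {R T : ℝ} (c : ℂ)
    (e1 : IntervalIntegrable (fun t : ℝ => E (t + T * I)) volume 0 R)
    (e2 : IntervalIntegrable (fun y : ℝ => E (R + y * I)) volume 0 T)
    (e3 : IntervalIntegrable (fun y : ℝ => E (y * I)) volume 0 T)
    (f1 : IntervalIntegrable (fun t : ℝ => F (t + T * I)) volume 0 R)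
    (f2 : IntervalIntegrable (fun y : ℝ => F (R + y * I)) volume 0 T)
    (f3 : IntervalIntegrable (fun y : ℝ => F (y * I)) volume 0 T) :
    sidesIntegral (fun z => E z - c * F z) R T = sidesIntegral E R T - c * sidesIntegral F R T := by
  unfold sidesIntegral
  rw [intervalIntegral.integral_sub e1 (f1.const_mul c),
    intervalIntegral.integral_sub e2 (f2.const_mul c),
    intervalIntegral.integral_sub e3 (f3.const_mul c)]
  simp only [intervalIntegral.integral_const_mul]
  ring

theorem dslope_ofReal_eq (G : ℂ → ℂ) {x : ℝ} {z : ℂ} (hz : z ≠ x) :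
    dslope G x z = G z / (z - x) - G x * (z - x)⁻¹ := by
  rw [dslope_of_ne _ hz, slope_def_field, sub_div, div_eq_mul_inv (G x)]

namespace RotatableOnQuadrant

variable {σ x : ℝ} {N : ℕ} {G : ℂ → ℂ}

theorem intervalIntegrable_axis (h : RotatableOnQuadrant σ x N G) (hσ : σ = 1 ∨ σ = -1) {R : ℝ}
    (hR : 0 ≤ R) :
    IntervalIntegrable (fun y : ℝ => G (y * I) / (y * I - x)) volume 0 (σ * R) := by
  have hσ0 : σ ≠ 0 := by rcases hσ with rfl | rfl <;> norm_num
  have h1 : IntervalIntegrable (fun y : ℝ => G ((σ * y : ℝ) * I) / ((σ * y : ℝ) * I - x))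
      volume 0 R := by
    rw [intervalIntegrable_iff_integrableOn_Ioc_of_le hR]
    exact h.integrableOn_axis.mono_set fun y hy => hy.1
  have h2 := (IntervalIntegrable.comp_mul_left_iff (c := σ) hσ0 (a := 0) (b := σ * R)
    (f := fun y : ℝ => G (y * I) / (y * I - x))).1 ?_
  · exact h2
  · rwa [zero_div, mul_div_cancel_left₀ _ hσ0]

theorem continuousOn_dslope (h : RotatableOnQuadrant σ x N G) (hx : 0 < x) :
    ContinuousOn (dslope G x) (puncturedQuadrant σ) := by
  intro z hz
  rcases eq_or_ne z x with rfl | hne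
  · refine (continuousAt_dslope_same.2 ?_).continuousWithinAt
    exact h.differentiableOn.differentiableAt
      ((isOpen_lt continuous_const continuous_re).mem_nhds (by simpa using hx))
  · exact (continuousWithinAt_dslope_of_ne hne).2 (h.continuousOn z hz)

theorem differentiableOn_dslope (h : RotatableOnQuadrant σ x N G) (hx : 0 < x) :
    DifferentiableOn ℂ (dslope G x) {z | 0 < z.re} :=
  (Complex.differentiableOn_dslope ((isOpen_lt continuous_const continuous_re).mem_nhds
    (by simpa using hx))).2 h.differentiableOn

theorem bound_zero_dslope (h : RotatableOnQuadrant σ x N G) (hx : 0 < x) :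
    ∃ C r : ℝ, 0 < r ∧ ∀ z ∈ puncturedQuadrant σ, ‖z‖ < r → ‖dslope G x z‖ * ‖z‖ ^ N ≤ C := by
  obtain ⟨C, r, hr, hC⟩ := h.bound_zero
  refine ⟨(C + ‖G x‖) / (x / 2), min r (min 1 (x / 2)), by positivity, fun z hz hzr => ?_⟩
  have h1 : ‖z‖ < r := hzr.trans_le (min_le_left _ _)
  have h2 : ‖z‖ < 1 := hzr.trans_le ((min_le_right _ _).trans (min_le_left _ _))
  have h3 : ‖z‖ < x / 2 := hzr.trans_le ((min_le_right _ _).trans (min_le_right _ _))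
  have hzx : x / 2 ≤ ‖z - x‖ := by
    have := norm_sub_norm_le (x : ℂ) z
    rw [norm_real, Real.norm_of_nonneg hx.le, norm_sub_rev] at this
    linarith
  have hne : z ≠ x := fun h => by
    rw [h, sub_self, norm_zero] at hzx; linarith
  rw [dslope_ofReal_eq G hne, ← div_eq_mul_inv, ← sub_div, norm_div, div_mul_eq_mul_div]
  refine div_le_div₀ ?_ ?_ (by positivity) hzx
  · have := (by positivity : 0 ≤ ‖G z‖ * ‖z‖ ^ N).trans (hC z hz h1)
    positivity
  · calc ‖G z - G x‖ * ‖z‖ ^ N ≤ (‖G z‖ + ‖G x‖) * ‖z‖ ^ N := by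
          gcongr; exact norm_sub_le _ _
      _ = ‖G z‖ * ‖z‖ ^ N + ‖G x‖ * ‖z‖ ^ N := by ring
      _ ≤ C + ‖G x‖ * 1 := by
        gcongr
        · exact hC z hz h1
        · exact pow_le_one₀ (norm_nonneg _) h2.le
      _ = _ := by rw [mul_one]

theorem ofReal_mul_I_sub_ne_zero (hx : 0 < x) (y : ℝ) : (y : ℂ) * I - x ≠ 0 := fun h => by
  have := congrArg Complex.re h
  simp [hx.ne'] at this

theorem intervalIntegrable_axis_inv (hx : 0 < x) (a b : ℝ) :
    IntervalIntegrable (fun y : ℝ => ((y : ℂ) * I - x)⁻¹) volume a b :=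
  ContinuousOn.intervalIntegrable
    (ContinuousOn.inv₀ (by fun_prop) fun y _ => ofReal_mul_I_sub_ne_zero hx y)

theorem intervalIntegrable_axis_dslope (h : RotatableOnQuadrant σ x N G) (hσ : σ = 1 ∨ σ = -1)
    (hx : 0 < x) {R : ℝ} (hR : 0 ≤ R) :
    IntervalIntegrable (fun y : ℝ => dslope G x (y * I)) volume 0 (σ * R) := by
  have h1 : (fun y : ℝ => dslope G x (y * I)) = fun y : ℝ =>
      G (y * I) / (y * I - x) - G x * (y * I - x : ℂ)⁻¹ := funext fun y =>
    dslope_ofReal_eq G (sub_ne_zero.1 (ofReal_mul_I_sub_ne_zero hx y))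
  rw [h1]
  exact (h.intervalIntegrable_axis hσ hR).sub ((intervalIntegrable_axis_inv hx _ _).const_mul _)

/-- The limit of the integral along the three outer sides of large squares. -/
theorem tendsto_sidesIntegral (h : RotatableOnQuadrant σ x N G) (hσ : σ = 1 ∨ σ = -1)
    (hx : 0 < x) :
    Tendsto (fun R : ℝ => sidesIntegral (dslope G x) R (σ * R) + G x * Real.log ((R - x) / x))
      atTop (𝓝 (σ * Real.pi * I * G x +
        I * (σ * ∫ y in Ioi (0 : ℝ), G ((σ * y : ℝ) * I) / ((σ * y : ℝ) * I - x)))) := by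
  have hσ2 : σ * σ = 1 := by rcases hσ with rfl | rfl <;> norm_num
  have hσ0 : σ ≠ 0 := by rcases hσ with rfl | rfl <;> norm_num
  obtain ⟨a, s, C, R₀, ha, hs, hG⟩ := h.bound_infty
  have hfar := tendsto_far_sides hσ ha hs hx hG
  have hax : Tendsto (fun R : ℝ => ∫ y in (0 : ℝ)..(σ * R), G (y * I) / (y * I - x)) atTop
      (𝓝 (σ * ∫ y in Ioi (0 : ℝ), G ((σ * y : ℝ) * I) / ((σ * y : ℝ) * I - x))) := by
    have := (intervalIntegral_tendsto_integral_Ioi 0 h.integrableOn_axis tendsto_id).const_mul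
      (σ : ℂ)
    refine this.congr fun R => ?_
    rw [← real_smul, id, intervalIntegral.smul_integral_comp_mul_left
      (fun y : ℝ => G (y * I) / (y * I - x)) σ, mul_zero]
  have hsum := (hfar.add (hax.const_mul I)).add_const (σ * Real.pi * I * G x)
  rw [zero_add, add_comm (I * _)] at hsum
  refine hsum.congr' ?_
  filter_upwards [eventually_gt_atTop x] with R hR
  have hR0 : 0 < R := hx.trans hR
  have n1 : ∀ t : ℝ, (t : ℂ) + (σ * R : ℝ) * I - x ≠ 0 := fun t h => by
    have := congrArg Complex.im h
    simp [hσ0, hR0.ne'] at this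
  have n2 : ∀ y : ℝ, (R : ℂ) + y * I - x ≠ 0 := fun y h => by
    have := congrArg Complex.re h
    simp [sub_eq_zero, hR.ne'] at this
  have e1 : IntervalIntegrable (fun t : ℝ => G (t + (σ * R : ℝ) * I) / (t + (σ * R : ℝ) * I - x))
      volume 0 R := by
    refine ContinuousOn.intervalIntegrable (ContinuousOn.div (h.continuousOn.comp (by fun_prop)
      fun t ht => ?_) (by fun_prop) fun t _ => n1 t)
    rw [uIcc_of_le hR0.le] at ht
    refine ⟨by simpa using ht.1, ?_, fun h => ?_⟩
    · simp [← mul_assoc, hσ2, hR0.le]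
    · have := congrArg Complex.im h
      simp [hσ0, hR0.ne'] at this
  have e2 : IntervalIntegrable (fun y : ℝ => G (R + y * I) / (R + y * I - x))
      volume 0 (σ * R) := by
    refine ContinuousOn.intervalIntegrable (ContinuousOn.div (h.continuousOn.comp (by fun_prop)
      fun y hy => ?_) (by fun_prop) fun y _ => n2 y)
    refine ⟨by simpa using hR0.le, ?_, fun h => ?_⟩
    · simpa using sigma_mul_nonneg_of_mem_uIcc hσ hR0.le hy
    · have := congrArg Complex.re h
      simp [hR0.ne'] at this
  have f1 : IntervalIntegrable (fun t : ℝ => ((t : ℂ) + (σ * R : ℝ) * I - x)⁻¹) volume 0 R :=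
    ContinuousOn.intervalIntegrable (ContinuousOn.inv₀ (by fun_prop) fun t _ => n1 t)
  have f2 : IntervalIntegrable (fun y : ℝ => ((R : ℂ) + y * I - x)⁻¹) volume 0 (σ * R) :=
    ContinuousOn.intervalIntegrable (ContinuousOn.inv₀ (by fun_prop) fun t _ => n2 t)
  have hsub := sidesIntegral_sub_const_mul (E := fun z => G z / (z - x))
    (F := fun z => (z - x : ℂ)⁻¹) (G x) e1 e2 (h.intervalIntegrable_axis hσ hR0.le) f1 f2
    (intervalIntegrable_axis_inv hx _ _)
  have hds : sidesIntegral (dslope G x) R (σ * R) =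
      sidesIntegral (fun z => G z / (z - x) - G x * (z - x : ℂ)⁻¹) R (σ * R) := by
    unfold sidesIntegral
    congr 2
    · congr 1
      funext t
      exact dslope_ofReal_eq G (sub_ne_zero.1 (n1 t))
    · congr 2
      funext y
      exact dslope_ofReal_eq G (sub_ne_zero.1 (n2 y))
    · congr 1
      funext y
      exact dslope_ofReal_eq G (sub_ne_zero.1 (ofReal_mul_I_sub_ne_zero hx y))
  rw [hds, hsub, sidesIntegral_inv_sub hσ hx hR, sidesIntegral]
  ring

end RotatableOnQuadrant

/-! ### Principal values -/

/-- Subtracting a simple pole reduces a principal value to an ordinary improper integral; the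
symmetric excision leaves exactly the logarithm. -/
theorem hasPVIntegral_of_sub_pole {F D : ℝ → ℂ} {x : ℝ} {c L : ℂ} (hx : 0 < x)
    (hF : ∀ t, 0 < t → t ≠ x → F t = D t + c * ((t : ℂ) - x)⁻¹)
    (hD : ∀ R, 0 ≤ R → IntervalIntegrable D volume 0 R) (hDx : ContinuousAt D x)
    (hL : Tendsto (fun R : ℝ => (∫ t in (0 : ℝ)..R, D t) + c * Real.log ((R - x) / x)) atTop
      (𝓝 L)) : HasPVIntegral F x L := by
  have hDab : ∀ a b, 0 ≤ a → 0 ≤ b → IntervalIntegrable D volume a b := fun a b ha hb =>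
    (hD a ha).symm.trans (hD b hb)
  have hinv : ∀ a b, a ≤ b → (b < x ∨ x < a) →
      IntervalIntegrable (fun t : ℝ => c * ((t : ℂ) - x)⁻¹) volume a b := by
    intro a b hab h
    refine ContinuousOn.intervalIntegrable (continuousOn_const.mul (ContinuousOn.inv₀ (by fun_prop)
      fun t ht h0 => ?_))
    rw [uIcc_of_le hab] at ht
    rw [sub_eq_zero, ofReal_inj] at h0
    rcases h with h | h
    · linarith [ht.2]
    · linarith [ht.1]
  have hcongr : ∀ a b, 0 ≤ a → a ≤ b → (b < x ∨ x < a) → ∀ t ∈ uIoc a b,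
      D t + c * ((t : ℂ) - x)⁻¹ = F t := by
    intro a b ha hab h t ht
    rw [uIoc_of_le hab] at ht
    refine (hF t (ha.trans_lt ht.1) fun h0 => ?_).symm
    rcases h with h | h
    · linarith [ht.2]
    · linarith [ht.1]
  have hFint : ∀ a b, 0 ≤ a → a ≤ b → (b < x ∨ x < a) → IntervalIntegrable F volume a b := by
    intro a b ha hab h
    exact ((hDab a b ha (ha.trans hab)).add (hinv a b hab h)).congr (hcongr a b ha hab h)
  have hval : ∀ a b, 0 ≤ a → a ≤ b → (b < x ∨ x < a) →
      (∫ t in a..b, F t) = (∫ t in a..b, D t) + c * Real.log ((b - x) / (a - x)) := by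
    intro a b ha hab h
    have h1 : (∫ t in a..b, ((t : ℂ) - x)⁻¹) = (Real.log ((b - x) / (a - x)) : ℂ) := by
      have h2 : (fun t : ℝ => ((t : ℂ) - x)⁻¹) = fun t : ℝ => (((t - x)⁻¹ : ℝ) : ℂ) := by
        funext t; push_cast; rfl
      rw [h2, intervalIntegral.integral_ofReal,
        intervalIntegral.integral_comp_sub_right (fun t : ℝ => t⁻¹) x, integral_inv]
      rw [uIcc_of_le (by linarith)]
      rintro ⟨h3, h4⟩
      rcases h with h | h <;> linarith
    rw [← intervalIntegral.integral_congr_ae (ae_of_all _ (hcongr a b ha hab h)),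
      intervalIntegral.integral_add (hDab a b ha (ha.trans hab)) (hinv a b hab h),
      intervalIntegral.integral_const_mul, h1]
  refine ⟨fun ε hε => ?_, fun ε R hε => ?_, ?_⟩
  · rcases le_total 0 (x - ε) with h | h
    · exact (intervalIntegrable_iff_integrableOn_Ioc_of_le h).1
        (hFint 0 (x - ε) le_rfl h (Or.inl (by linarith)))
    · rw [Ioc_eq_empty (by linarith)]; exact integrableOn_empty
  · rcases le_total (x + ε) R with h | h
    · exact (intervalIntegrable_iff_integrableOn_Ioc_of_le h).1
        (hFint (x + ε) R (by linarith) h (Or.inr (by linarith)))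
    · rw [Ioc_eq_empty (by linarith)]; exact integrableOn_empty
  · have hmid : Tendsto (fun ε : ℝ => ∫ t in (x - ε)..(x + ε), D t) (𝓝[>] 0) (𝓝 0) := by
      have hev : ∀ᶠ t in 𝓝 x, ‖D t‖ < ‖D x‖ + 1 :=
        hDx.norm.eventually_lt continuousAt_const (by linarith)
      obtain ⟨r, hr, hball⟩ := Metric.eventually_nhds_iff.1 hev
      have hlim : Tendsto (fun ε : ℝ => (‖D x‖ + 1) * |x + ε - (x - ε)|) (𝓝[>] 0) (𝓝 0) := by
        have : Continuous fun ε : ℝ => (‖D x‖ + 1) * |x + ε - (x - ε)| := by fun_prop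
        exact (this.tendsto' 0 0 (by simp)).mono_left nhdsWithin_le_nhds
      refine squeeze_zero_norm' ?_ hlim
      filter_upwards [Ioo_mem_nhdsGT hr] with ε hε
      refine intervalIntegral.norm_integral_le_of_norm_le_const fun t ht => ?_
      rw [uIoc_of_le (by linarith [hε.1])] at ht
      refine (hball ?_).le
      rw [Real.dist_eq, abs_lt]
      exact ⟨by linarith [ht.1, hε.2], by linarith [ht.2, hε.2]⟩
    have hlim := (hL.comp (tendsto_snd (f := 𝓝[>] (0 : ℝ)))).sub (hmid.comp tendsto_fst)
    rw [sub_zero] at hlim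
    refine hlim.congr' ?_
    have hev : ∀ᶠ p : ℝ × ℝ in 𝓝[>] (0 : ℝ) ×ˢ atTop, p.1 ∈ Ioo 0 (min x 1) ∧ x + 1 < p.2 :=
      Eventually.prod_mk (pa := fun ε => ε ∈ Ioo 0 (min x 1)) (Ioo_mem_nhdsGT (lt_min hx one_pos))
        (eventually_gt_atTop (x + 1))
    filter_upwards [hev] with p hp
    obtain ⟨⟨h1, h2⟩, h3⟩ := hp
    have h4 : p.1 < x := h2.trans_le (min_le_left _ _)
    have h5 : p.1 < 1 := h2.trans_le (min_le_right _ _)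
    rw [hval 0 (x - p.1) le_rfl (by linarith) (Or.inl (by linarith)),
      hval (x + p.1) p.2 (by linarith) (by linarith) (Or.inr (by linarith))]
    have d1 := intervalIntegral.integral_add_adjacent_intervals
      (hD (x - p.1) (by linarith)) (hDab (x - p.1) (x + p.1) (by linarith) (by linarith))
    have d2 := intervalIntegral.integral_add_adjacent_intervals
      (hD (x + p.1) (by linarith)) (hDab (x + p.1) p.2 (by linarith) (by linarith))
    have l1 : Real.log ((x - p.1 - x) / (0 - x)) = Real.log p.1 - Real.log x := by
      rw [show (x - p.1 - x) / (0 - x) = p.1 / x by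
        rw [show x - p.1 - x = -p.1 by ring, zero_sub, neg_div_neg_eq],
        Real.log_div h1.ne' hx.ne']
    have l2 : Real.log ((p.2 - x) / (x + p.1 - x)) = Real.log (p.2 - x) - Real.log p.1 := by
      rw [show x + p.1 - x = p.1 by ring, Real.log_div (by linarith) h1.ne']
    have l3 : Real.log ((p.2 - x) / x) = Real.log (p.2 - x) - Real.log x :=
      Real.log_div (by linarith) hx.ne'
    simp only [Function.comp]
    rw [l1, l2, l3, ← d2, ← d1]
    push_cast
    ring

/-- The principal value of `(G₁ + G₂) / (t - x)`, evaluated by turning the contour of `G₁` to the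
positive and that of `G₂` to the negative imaginary axis. -/
theorem hasPVIntegral_of_rotatable {G₁ G₂ : ℂ → ℂ} {F : ℝ → ℂ} {x : ℝ} {N : ℕ} (hx : 0 < x)
    (hF : ∀ t : ℝ, 0 < t → F t = (G₁ t + G₂ t) / ((t : ℂ) - x))
    (h₁ : RotatableOnQuadrant 1 x N G₁) (h₂ : RotatableOnQuadrant (-1) x N G₂)
    (h0 : IntegrableAtFilter (fun t : ℝ => G₁ t + G₂ t) (𝓝[>] 0)) :
    HasPVIntegral F x
      (Real.pi * I * (G₁ x - G₂ x) +
        I * ((∫ y in Ioi (0 : ℝ), G₁ ((1 * y : ℝ) * I) / ((1 * y : ℝ) * I - x)) -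
          ∫ y in Ioi (0 : ℝ), G₂ ((-1 * y : ℝ) * I) / ((-1 * y : ℝ) * I - x))) := by
  set D : ℝ → ℂ := fun t => dslope G₁ x t + dslope G₂ x t with hD
  have hmem : ∀ (σ t : ℝ), 0 < t → (t : ℂ) ∈ puncturedQuadrant σ := fun σ t ht =>
    ⟨by simpa using ht.le, by simp, by simpa using ht.ne'⟩
  have hDc : ContinuousOn D (Ioi 0) :=
    ((h₁.continuousOn_dslope hx).comp (by fun_prop) fun t ht => hmem 1 t ht).add
      ((h₂.continuousOn_dslope hx).comp (by fun_prop) fun t ht => hmem (-1) t ht)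
  have hDeq : ∀ t : ℝ, t ≠ x →
      D t = (G₁ t + G₂ t - (G₁ x + G₂ x)) * ((t : ℂ) - x)⁻¹ := by
    intro t ht
    have ht' : (t : ℂ) ≠ x := by simpa using ht
    simp only [hD]
    rw [dslope_ofReal_eq G₁ ht', dslope_ofReal_eq G₂ ht']
    ring
  have hDint : ∀ R, 0 ≤ R → IntervalIntegrable D volume 0 R := by
    intro R hR
    rcases hR.eq_or_lt with rfl | hR
    · exact IntervalIntegrable.refl
    obtain ⟨u, hu, hint⟩ := h0
    obtain ⟨b, hb, hbu⟩ := (mem_nhdsGT_iff_exists_Ioc_subset).1 hu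
    set e := min b (min (x / 2) R) with he
    have he0 : 0 < e := lt_min hb (lt_min (half_pos hx) hR)
    have heb : e ≤ b := min_le_left _ _
    have hex : e ≤ x / 2 := (min_le_right _ _).trans (min_le_left _ _)
    have heR : e ≤ R := (min_le_right _ _).trans (min_le_right _ _)
    refine IntervalIntegrable.trans (b := e) ?_ ?_
    · have i1 : IntervalIntegrable (fun t : ℝ => G₁ t + G₂ t) volume 0 e := by
        rw [intervalIntegrable_iff_integrableOn_Ioc_of_le he0.le]
        exact hint.mono_set ((Ioc_subset_Ioc_right heb).trans hbu)
      have i2 : IntervalIntegrable (fun t : ℝ => (G₁ t + G₂ t - (G₁ x + G₂ x)) *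
          ((t : ℂ) - x)⁻¹) volume 0 e := by
        refine (i1.sub intervalIntegrable_const).mul_continuousOn
          (ContinuousOn.inv₀ (by fun_prop) fun t ht h => ?_)
        rw [uIcc_of_le he0.le] at ht
        rw [sub_eq_zero, ofReal_inj] at h
        linarith [ht.2]
      refine i2.congr fun t ht => (hDeq t fun h => ?_).symm
      rw [uIoc_of_le he0.le] at ht
      linarith [ht.2]
    · refine ContinuousOn.intervalIntegrable (hDc.mono fun t ht => ?_)
      rw [uIcc_of_le heR] at ht
      exact he0.trans_le ht.1
  obtain ⟨C₁, r₁, hr₁, hb₁⟩ := h₁.bound_zero_dslope hx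
  obtain ⟨C₂, r₂, hr₂, hb₂⟩ := h₂.bound_zero_dslope hx
  have hlim := (h₁.tendsto_sidesIntegral (Or.inl rfl) hx).add
    (h₂.tendsto_sidesIntegral (Or.inr rfl) hx)
  refine hasPVIntegral_of_sub_pole hx (D := D) (c := G₁ x + G₂ x) (fun t ht hne => ?_) hDint
    (hDc.continuousAt (Ioi_mem_nhds hx)) ?_
  · rw [hF t ht, hDeq t hne]; ring
  · convert! hlim.congr' ?_ using 2
    · push_cast; ring
    · filter_upwards [eventually_gt_atTop 0] with R hR
      have h := integral_add_eq_sidesIntegral (C := max C₁ C₂) (N := N) hR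
        (h₁.continuousOn_dslope hx)
        (h₂.continuousOn_dslope hx) (h₁.differentiableOn_dslope hx) (h₂.differentiableOn_dslope hx)
        (lt_min hr₁ hr₂)
        (fun z hz hzr => (hb₁ z hz (hzr.trans_le (min_le_left _ _))).trans (le_max_left _ _))
        (fun z hz hzr => (hb₂ z hz (hzr.trans_le (min_le_right _ _))).trans (le_max_right _ _))
        (h₁.intervalIntegrable_axis_dslope (Or.inl rfl) hx hR.le)
        (h₂.intervalIntegrable_axis_dslope (Or.inr rfl) hx hR.le) (hDint R hR.le)
      simp only [hD]
      rw [h]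
      ring

/-! ### Products with Hankel functions -/

/-- An algebraic bound at the origin extends to the imaginary axis by continuity. -/
theorem exists_norm_le_rpow_of_isBigO {f : ℂ → ℂ} {κ : ℝ}
    (hfc : ContinuousOn f ({z : ℂ | 0 ≤ z.re} \ {0}))
    (hf0 : f =O[𝓝[{z : ℂ | 0 < z.re}] 0] fun z : ℂ => ‖z‖ ^ κ) :
    ∃ C r : ℝ, 0 < C ∧ 0 < r ∧ ∀ z : ℂ, 0 ≤ z.re → z ≠ 0 → ‖z‖ < r → ‖f z‖ ≤ C * ‖z‖ ^ κ := by
  obtain ⟨C, hC0, hC⟩ := hf0.exists_pos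
  rw [Asymptotics.isBigOWith_iff] at hC
  obtain ⟨r, hr, hball⟩ := Metric.mem_nhdsWithin_iff.1 hC
  have hpos : ∀ z : ℂ, 0 < z.re → ‖z‖ < r → ‖f z‖ ≤ C * ‖z‖ ^ κ := fun z hz hzr => by
    have : ‖f z‖ ≤ C * ‖‖z‖ ^ κ‖ := hball ⟨mem_ball_zero_iff.2 hzr, hz⟩
    rwa [Real.norm_of_nonneg (Real.rpow_nonneg (norm_nonneg _) _)] at this
  refine ⟨C, r, hC0, hr, fun z hz hz0 hzr => ?_⟩
  have hcont : Continuous fun t : ℝ => z + t := by fun_prop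
  have hlim0 : Tendsto (fun t : ℝ => z + t) (𝓝[>] 0) (𝓝 z) :=
    (hcont.tendsto' 0 z (by simp)).mono_left nhdsWithin_le_nhds
  have hre : ∀ᶠ t : ℝ in 𝓝[>] 0, 0 < (z + t).re := by
    filter_upwards [self_mem_nhdsWithin] with t ht
    rw [add_re, ofReal_re]
    exact add_pos_of_nonneg_of_pos hz ht
  have hlim : Tendsto (fun t : ℝ => z + t) (𝓝[>] 0) (𝓝[{z : ℂ | 0 ≤ z.re} \ {0}] z) := by
    refine tendsto_nhdsWithin_of_tendsto_nhds_of_eventually_within _ hlim0 ?_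
    filter_upwards [hre] with t ht
    exact ⟨ht.le, fun h => by rw [mem_singleton_iff.1 h] at ht; simp at ht⟩
  have l1 := ((hfc z ⟨hz, hz0⟩).tendsto.comp hlim).norm
  have l2 : Tendsto (fun t : ℝ => C * ‖z + t‖ ^ κ) (𝓝[>] 0) (𝓝 (C * ‖z‖ ^ κ)) :=
    (hlim0.norm.rpow_const (Or.inl (norm_ne_zero_iff.2 hz0))).const_mul C
  refine le_of_tendsto_of_tendsto l1 l2 ?_
  filter_upwards [hre, hlim0.norm.eventually_lt_const hzr] with t h1 h2
  exact hpos _ h1 h2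

/-- If `f` has algebraic type at the origin and exponential type less than `ω`, its product with a
Hankel function of frequency `ω` that decays in the quadrant satisfies the conditions for rotation.
The square root in the decay of the Hankel function is what admits exponents `δ` up to `3 / 2`. -/
theorem rotatableOnQuadrant_mul {f H : ℂ → ℂ} {σ x κ δ d ω M B n C₀ r R₀ : ℝ} {N : ℕ} (c : ℂ)
    (hσ : σ = 1 ∨ σ = -1) (hM : 0 < M) (hδ : δ < 3 / 2) (hd : 0 ≤ d) (hdω : d < ω)
    (hB : 0 < B) (hn : 0 ≤ n) (hC₀ : 0 < C₀) (hr : 0 < r) (hN : 1 / 2 + n - κ ≤ N)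
    (hf : DifferentiableOn ℂ f {z : ℂ | 0 < z.re})
    (hfc : ContinuousOn f ({z : ℂ | 0 ≤ z.re} \ {0}))
    (hf0 : ∀ z : ℂ, 0 ≤ z.re → z ≠ 0 → ‖z‖ < r → ‖f z‖ ≤ C₀ * ‖z‖ ^ κ)
    (hfinf : ∀ z : ℂ, 0 < z.re → R₀ ≤ ‖z‖ → ‖f z‖ ≤ M * ‖z‖ ^ δ * Real.exp (d * z.im))
    (hH : ∀ z : ℂ, z.re ≠ 0 ∨ 0 < σ * z.im → DifferentiableAt ℂ H z)
    (hHb : ∀ z : ℂ, 0 ≤ σ * z.im → z ≠ 0 →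
      ‖H z‖ ≤ B * Real.exp (-(σ * z.im)) * (√‖z‖)⁻¹ * (1 + (√‖z‖)⁻¹) ^ (2 * n))
    (hax : IntegrableOn (fun y : ℝ => c * (f ((σ * y : ℝ) * I) * H (ω * ((σ * y : ℝ) * I))) /
      ((σ * y : ℝ) * I - x)) (Ioi 0)) :
    RotatableOnQuadrant σ x N (fun z => c * (f z * H (ω * z))) := by
  have hω : 0 < ω := hd.trans_lt hdω
  have hHd : ∀ z : ℂ, z.re ≠ 0 ∨ 0 < σ * z.im → DifferentiableAt ℂ (fun z : ℂ => H (ω * z)) z := by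
    intro z hz
    refine DifferentiableAt.comp (f := fun z : ℂ => (ω : ℂ) * z) z (hH _ ?_) (by fun_prop)
    rw [re_ofReal_mul, im_ofReal_mul]
    rcases hz with h | h
    · exact Or.inl (mul_ne_zero hω.ne' h)
    · right
      rw [mul_left_comm]
      exact mul_pos hω h
  have hHω : ∀ z : ℂ, 0 ≤ σ * z.im → z ≠ 0 → ‖H (ω * z)‖ ≤ B * Real.exp (-(ω * (σ * z.im))) *
      (√(ω * ‖z‖))⁻¹ * (1 + (√(ω * ‖z‖))⁻¹) ^ (2 * n) := by
    intro z hz hz0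
    have h := hHb (ω * z) (by rw [im_ofReal_mul, mul_left_comm]; positivity)
      (mul_ne_zero (by exact_mod_cast hω.ne') hz0)
    rwa [norm_mul, norm_real, Real.norm_of_nonneg hω.le, im_ofReal_mul, mul_left_comm] at h
  refine ⟨?_, ?_, ?_, ?_, hax⟩
  · intro z hz
    obtain ⟨h1, h2, h3⟩ := hz
    refine continuousWithinAt_const.mul (ContinuousWithinAt.mul
      ((hfc z ⟨h1, h3⟩).mono fun w hw => ⟨hw.1, hw.2.2⟩) ?_)
    refine (hHd z ?_).continuousAt.continuousWithinAt
    by_contra! hcon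
    have him : z.im = 0 := by
      have : σ * z.im = 0 := le_antisymm hcon.2 h2
      rcases hσ with rfl | rfl <;> linarith
    exact h3 (Complex.ext hcon.1 him)
  · intro z hz
    exact ((hf z hz).mul
      (hHd z (Or.inl (ne_of_gt hz))).differentiableWithinAt).const_mul c
  · refine ⟨‖c‖ * (C₀ * (B * 2 ^ (2 * n) * ω ^ (-(1 / 2 + n)))), min r (min 1 ω⁻¹), by positivity,
      fun z hz hzr => ?_⟩
    obtain ⟨h1, h2, h3⟩ := hz
    have hz0 : 0 < ‖z‖ := norm_pos_iff.2 h3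
    have r1 : ‖z‖ < r := hzr.trans_le (min_le_left _ _)
    have r2 : ‖z‖ < 1 := hzr.trans_le ((min_le_right _ _).trans (min_le_left _ _))
    have r3 : ‖z‖ < ω⁻¹ := hzr.trans_le ((min_le_right _ _).trans (min_le_right _ _))
    have hu0 : 0 < √(ω * ‖z‖) := Real.sqrt_pos.2 (by positivity)
    have hu1 : √(ω * ‖z‖) ≤ 1 := by
      refine (Real.sqrt_le_sqrt (y := 1) ?_).trans_eq Real.sqrt_one
      calc ω * ‖z‖ ≤ ω * ω⁻¹ := by gcongr
        _ = 1 := mul_inv_cancel₀ hω.ne'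
    have hHz : ‖H (ω * z)‖ ≤ B * 2 ^ (2 * n) * ω ^ (-(1 / 2 + n)) * ‖z‖ ^ (-(1 / 2 + n)) := by
      have e1 : (√(ω * ‖z‖))⁻¹ * (√(ω * ‖z‖))⁻¹ ^ (2 * n) =
          ω ^ (-(1 / 2 + n)) * ‖z‖ ^ (-(1 / 2 + n)) := by
        rw [← Real.mul_rpow hω.le hz0.le, Real.sqrt_eq_rpow, ← Real.rpow_neg (by positivity),
          ← Real.rpow_mul (by positivity), ← Real.rpow_add (by positivity)]
        congr 1; ring
      have e2 : 1 + (√(ω * ‖z‖))⁻¹ ≤ 2 * (√(ω * ‖z‖))⁻¹ := by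
        have := (one_le_inv₀ hu0).2 hu1
        linarith
      have e3 : Real.exp (-(ω * (σ * z.im))) ≤ 1 := by
        rw [Real.exp_le_one_iff]
        have : 0 ≤ ω * (σ * z.im) := by positivity
        linarith
      calc ‖H (ω * z)‖ ≤ _ := hHω z h2 h3
        _ ≤ B * 1 * (√(ω * ‖z‖))⁻¹ * (2 * (√(ω * ‖z‖))⁻¹) ^ (2 * n) := by gcongr
        _ = B * 2 ^ (2 * n) * ((√(ω * ‖z‖))⁻¹ * (√(ω * ‖z‖))⁻¹ ^ (2 * n)) := by
          rw [Real.mul_rpow (by positivity) (by positivity)]; ring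
        _ = _ := by rw [e1]; ring
    rw [norm_mul, norm_mul]
    have hpow : ‖z‖ ^ κ * ‖z‖ ^ (-(1 / 2 + n)) * ‖z‖ ^ N ≤ 1 := by
      rw [← Real.rpow_natCast, ← Real.rpow_add hz0, ← Real.rpow_add hz0]
      exact Real.rpow_le_one hz0.le r2.le (by linarith)
    calc ‖c‖ * (‖f z‖ * ‖H (ω * z)‖) * ‖z‖ ^ N
        ≤ ‖c‖ * ((C₀ * ‖z‖ ^ κ) *
          (B * 2 ^ (2 * n) * ω ^ (-(1 / 2 + n)) * ‖z‖ ^ (-(1 / 2 + n)))) * ‖z‖ ^ N := by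
          gcongr
          exact hf0 z h1 h3 r1
      _ = ‖c‖ * (C₀ * (B * 2 ^ (2 * n) * ω ^ (-(1 / 2 + n)))) *
          (‖z‖ ^ κ * ‖z‖ ^ (-(1 / 2 + n)) * ‖z‖ ^ N) := by ring
      _ ≤ ‖c‖ * (C₀ * (B * 2 ^ (2 * n) * ω ^ (-(1 / 2 + n)))) * 1 := by gcongr
      _ = _ := mul_one _
  · refine ⟨ω - d, δ - 1 / 2, ‖c‖ * (M * (B * 2 ^ (2 * n) * (√ω)⁻¹)), max R₀ ω⁻¹, by linarith,
      by linarith, fun z h1 h2 hzR => ?_⟩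
    have r1 : R₀ ≤ ‖z‖ := (le_max_left _ _).trans hzR
    have r2 : ω⁻¹ ≤ ‖z‖ := (le_max_right _ _).trans hzR
    have hz0 : 0 < ‖z‖ := (inv_pos.2 hω).trans_le r2
    have hu1 : 1 ≤ √(ω * ‖z‖) := by
      rw [Real.one_le_sqrt]
      calc 1 = ω * ω⁻¹ := (mul_inv_cancel₀ hω.ne').symm
        _ ≤ ω * ‖z‖ := by gcongr
    have e1 : 1 + (√(ω * ‖z‖))⁻¹ ≤ 2 := by
      have := inv_le_one_of_one_le₀ hu1
      linarith
    have e2 : Real.exp (d * z.im) * Real.exp (-(ω * (σ * z.im))) ≤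
        Real.exp (-((ω - d) * (σ * z.im))) := by
      rw [← Real.exp_add, Real.exp_le_exp]
      have : z.im ≤ σ * z.im := by rcases hσ with rfl | rfl <;> linarith
      nlinarith [mul_le_mul_of_nonneg_left this hd]
    have e3 : ‖z‖ ^ δ * (√(ω * ‖z‖))⁻¹ = (√ω)⁻¹ * ‖z‖ ^ (δ - 1 / 2) := by
      rw [Real.sqrt_mul hω.le, Real.rpow_sub hz0, ← Real.sqrt_eq_rpow, mul_inv]
      ring
    rw [norm_mul, norm_mul]
    calc ‖c‖ * (‖f z‖ * ‖H (ω * z)‖)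
        ≤ ‖c‖ * ((M * ‖z‖ ^ δ * Real.exp (d * z.im)) * (B * Real.exp (-(ω * (σ * z.im))) *
          (√(ω * ‖z‖))⁻¹ * 2 ^ (2 * n))) := by
          gcongr
          · exact hfinf z h1 r1
          · refine (hHω z h2 (norm_pos_iff.1 hz0)).trans ?_
            gcongr
      _ = ‖c‖ * (M * (B * 2 ^ (2 * n))) * (‖z‖ ^ δ * (√(ω * ‖z‖))⁻¹) *
          (Real.exp (d * z.im) * Real.exp (-(ω * (σ * z.im)))) := by ring
      _ ≤ ‖c‖ * (M * (B * 2 ^ (2 * n))) * (‖z‖ ^ δ * (√(ω * ‖z‖))⁻¹) *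
          Real.exp (-((ω - d) * (σ * z.im))) := by gcongr
      _ = _ := by rw [e3]; ring

/-- The term of the integrands with `besselG 1` and `besselG 2` that carries the values of `f` on the
positive imaginary axis. -/
noncomputable def axisUpper (ν : ℂ) (f : ℂ → ℂ) (ω x y : ℝ) : ℂ :=
  besselK ν (ω * y) / ((y : ℂ) ^ 2 + (x : ℂ) ^ 2) *
    ((x + I * y) * cexp (-(ν / 2 * Real.pi * I)) * f (I * y))

/-- The term of the integrand with `besselG 1` that carries the values of `f` on the negative
imaginary axis; with `besselG 2` it enters with the opposite sign. -/
noncomputable def axisLower (ν : ℂ) (f : ℂ → ℂ) (ω x y : ℝ) : ℂ :=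
  besselK ν (ω * y) / ((y : ℂ) ^ 2 + (x : ℂ) ^ 2) *
    ((x - I * y) * cexp (ν / 2 * Real.pi * I) * f (-(I * y)))

theorem besselG_one_eq (ν : ℂ) (f : ℂ → ℂ) (ω x y : ℝ) :
    besselK ν (ω * y) / ((y : ℂ) ^ 2 + (x : ℂ) ^ 2) * besselG 1 ν f x y =
      axisUpper ν f ω x y + axisLower ν f ω x y := by
  rw [besselG, axisUpper, axisLower]; ring

theorem besselG_two_eq (ν : ℂ) (f : ℂ → ℂ) (ω x y : ℝ) :
    besselK ν (ω * y) / ((y : ℂ) ^ 2 + (x : ℂ) ^ 2) * besselG 2 ν f x y =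
      axisUpper ν f ω x y - axisLower ν f ω x y := by
  rw [besselG, axisUpper, axisLower]; ring

theorem sq_add_sq_ne_zero {x : ℝ} (hx : 0 < x) (y : ℝ) : (y : ℂ) ^ 2 + (x : ℂ) ^ 2 ≠ 0 := by
  have : y ^ 2 + x ^ 2 ≠ 0 := by positivity
  exact_mod_cast this

theorem mul_hankelOne_div_eq_axisUpper (ν c : ℂ) (f : ℂ → ℂ) {ω x y : ℝ} (hω : 0 < ω)
    (hx : 0 < x) (hy : 0 < y) :
    c * (f ((1 * y : ℝ) * I) * hankelOne ν (ω * ((1 * y : ℝ) * I))) / ((1 * y : ℝ) * I - x) =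
      -(2 / (Real.pi * I)) * c * axisUpper ν f ω x y := by
  have h0 := sq_add_sq_ne_zero hx y
  have h1 := RotatableOnQuadrant.ofReal_mul_I_sub_ne_zero hx y
  have h2 := hankelOne_I_mul ν (mul_pos hω hy)
  rw [one_mul, show (ω : ℂ) * ((y : ℂ) * I) = I * ((ω * y : ℝ) : ℂ) by push_cast; ring, h2,
    axisUpper, mul_comm (y : ℂ) I]
  rw [mul_comm (y : ℂ) I] at h1
  have e : (I * (y : ℂ) - x)⁻¹ = -(x + I * y) / ((y : ℂ) ^ 2 + (x : ℂ) ^ 2) := by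
    rw [inv_eq_one_div, div_eq_div_iff h1 h0]
    linear_combination (y : ℂ) ^ 2 * I_sq
  rw [div_eq_mul_inv _ (I * (y : ℂ) - x), e]
  push_cast
  ring

theorem mul_hankelTwo_div_eq_axisLower (ν c : ℂ) (f : ℂ → ℂ) {ω x y : ℝ} (hω : 0 < ω)
    (hx : 0 < x) (hy : 0 < y) :
    c * (f ((-1 * y : ℝ) * I) * hankelTwo ν (ω * ((-1 * y : ℝ) * I))) / ((-1 * y : ℝ) * I - x) =
      2 / (Real.pi * I) * c * axisLower ν f ω x y := by
  have h0 := sq_add_sq_ne_zero hx y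
  have h1 := RotatableOnQuadrant.ofReal_mul_I_sub_ne_zero hx (-1 * y)
  have h2 := hankelTwo_neg_I_mul ν (mul_pos hω hy)
  rw [show (ω : ℂ) * (((-1 * y : ℝ) : ℂ) * I) = -(I * ((ω * y : ℝ) : ℂ)) by push_cast; ring, h2,
    axisLower]
  rw [show ((-1 * y : ℝ) : ℂ) * I = -(I * y) by push_cast; ring] at h1 ⊢
  have e : (-(I * (y : ℂ)) - x)⁻¹ = -(x - I * y) / ((y : ℂ) ^ 2 + (x : ℂ) ^ 2) := by
    rw [inv_eq_one_div, div_eq_div_iff h1 h0]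
    linear_combination (y : ℂ) ^ 2 * I_sq
  rw [div_eq_mul_inv _ (-(I * (y : ℂ)) - x), e]
  push_cast
  ring

/-! ### The principal value formulas -/

/-- The principal value for an arbitrary combination of the two Hankel functions.  The two formulas
for `J` and `Y` are the special cases `(H₁ + H₂) / 2` and `(H₁ - H₂) / (2 i)`. -/
theorem hasPVIntegral_hankel {f : ℂ → ℂ} {ν c₁ c₂ : ℂ} {b : ℝ → ℂ} {M δ d ω x : ℝ}
    (hM : 0 < M) (hδ : δ < 3 / 2) (hd : 0 ≤ d) (hdω : d < ω) (hx : 0 < x)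
    (hf : DifferentiableOn ℂ f {z : ℂ | 0 < z.re})
    (hfc : ContinuousOn f ({z : ℂ | 0 ≤ z.re} \ {0}))
    (hf0 : ∃ κ : ℝ, f =O[𝓝[{z : ℂ | 0 < z.re}] 0] fun z : ℂ => ‖z‖ ^ κ)
    (hgrowth : ∀ᶠ z : ℂ in Bornology.cobounded ℂ ⊓ 𝓟 {z : ℂ | 0 < z.re},
      ‖f z‖ ≤ M * ‖z‖ ^ δ * Real.exp (d * z.im))
    (hA : IntegrableOn (axisUpper ν f ω x) (Ioi 0)) (hB : IntegrableOn (axisLower ν f ω x) (Ioi 0))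
    (hb : ∀ t : ℝ, 0 < t → b t = c₁ * hankelOne ν (ω * t) + c₂ * hankelTwo ν (ω * t))
    (h0 : IntegrableAtFilter (fun t : ℝ => f t * b t) (𝓝[>] 0)) :
    HasPVIntegral (fun t : ℝ => f t / ((t : ℂ) - x) * b t) x
      (Real.pi * I * f x * (c₁ * hankelOne ν (ω * x) - c₂ * hankelTwo ν (ω * x)) -
        2 / Real.pi * (c₁ * (∫ y in Ioi 0, axisUpper ν f ω x y) +
          c₂ * ∫ y in Ioi 0, axisLower ν f ω x y)) := by
  have hω : 0 < ω := hd.trans_lt hdω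
  obtain ⟨κ, hκ⟩ := hf0
  obtain ⟨C₀, r, hC₀, hr, hfz⟩ := exists_norm_le_rpow_of_isBigO hfc hκ
  obtain ⟨R₀, hR₀⟩ : ∃ R₀ : ℝ, ∀ z : ℂ, 0 < z.re → R₀ ≤ ‖z‖ →
      ‖f z‖ ≤ M * ‖z‖ ^ δ * Real.exp (d * z.im) := by
    rw [eventually_inf_principal] at hgrowth
    obtain ⟨R₀, -, h⟩ := hasBasis_cobounded_norm.eventually_iff.1 hgrowth
    exact ⟨R₀, fun z hz hzR => h hzR hz⟩
  obtain ⟨N, hN⟩ := exists_nat_ge (1 / 2 + ‖ν‖ - κ)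
  obtain ⟨B₁, hB₁, hH₁⟩ := exists_norm_hankelOne_le ν
  obtain ⟨B₂, hB₂, hH₂⟩ := exists_norm_hankelTwo_le ν
  have eA : ∀ y ∈ Ioi (0 : ℝ), c₁ * (f ((1 * y : ℝ) * I) * hankelOne ν (ω * ((1 * y : ℝ) * I))) /
      ((1 * y : ℝ) * I - x) = -(2 / (Real.pi * I)) * c₁ * axisUpper ν f ω x y :=
    fun y hy => mul_hankelOne_div_eq_axisUpper ν c₁ f hω hx hy
  have eB : ∀ y ∈ Ioi (0 : ℝ), c₂ * (f ((-1 * y : ℝ) * I) *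
      hankelTwo ν (ω * ((-1 * y : ℝ) * I))) / ((-1 * y : ℝ) * I - x) =
      2 / (Real.pi * I) * c₂ * axisLower ν f ω x y :=
    fun y hy => mul_hankelTwo_div_eq_axisLower ν c₂ f hω hx hy
  have r1 : RotatableOnQuadrant 1 x N (fun z => c₁ * (f z * hankelOne ν (ω * z))) := by
    refine rotatableOnQuadrant_mul c₁ (Or.inl rfl) hM hδ hd hdω hB₁ (norm_nonneg ν) hC₀ hr hN hf hfc
      hfz hR₀ (fun z hz => differentiableAt_hankelOne ν (by simpa using hz)) (fun z hz hz0 => ?_) ?_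
    · simpa using hH₁ z (by simpa using hz) hz0
    · exact (integrableOn_congr_fun eA measurableSet_Ioi).2 (hA.const_mul _)
  have r2 : RotatableOnQuadrant (-1) x N (fun z => c₂ * (f z * hankelTwo ν (ω * z))) := by
    refine rotatableOnQuadrant_mul c₂ (Or.inr rfl) hM hδ hd hdω hB₂ (norm_nonneg ν) hC₀ hr hN hf hfc
      hfz hR₀ (fun z hz => differentiableAt_hankelTwo ν (by simpa using hz)) (fun z hz hz0 => ?_) ?_
    · simpa using hH₂ z (by simpa using hz) hz0
    · exact (integrableOn_congr_fun eB measurableSet_Ioi).2 (hB.const_mul _)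
  have h := hasPVIntegral_of_rotatable (F := fun t : ℝ => f t / ((t : ℂ) - x) * b t) hx
    (fun t ht => ?_) r1 r2 ?_
  · convert h using 1
    rw [setIntegral_congr_fun measurableSet_Ioi eA, setIntegral_congr_fun measurableSet_Ioi eB,
      integral_const_mul, integral_const_mul]
    have hpi : (Real.pi : ℂ) ≠ 0 := by exact_mod_cast Real.pi_ne_zero
    field_simp
    ring
  · rw [hb t ht]; ring
  · obtain ⟨u, hu, hint⟩ := h0
    refine ⟨u ∩ Ioi 0, inter_mem hu self_mem_nhdsWithin,
      (hint.mono_set inter_subset_left).congr ?_⟩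
    filter_upwards [ae_mono (Measure.restrict_mono inter_subset_right le_rfl)
      (ae_restrict_mem measurableSet_Ioi)] with t ht
    rw [hb t ht]; ring

theorem mainTheorem4 (ν : ℂ) (f : ℂ → ℂ) (M δ d ω x : ℝ)
    (hM : 0 < M) (hδ : δ < 3 / 2) (hd : 0 ≤ d) (hdω : d < ω) (hx : 0 < x)
    -- `f` is analytic in the right half-plane, up to the imaginary axis except at the origin
    (hf : DifferentiableOn ℂ f {z : ℂ | 0 < z.re})
    (hfc : ContinuousOn f ({z : ℂ | 0 ≤ z.re} \ {0}))
    -- at the origin there is at most a singularity of algebraic type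
    (hf0 : ∃ κ : ℝ, f =O[𝓝[{z : ℂ | 0 < z.re}] 0] fun z : ℂ => ‖z‖ ^ κ)
    -- growth as `|z| → ∞` in the right half-plane
    (hgrowth : ∀ᶠ z : ℂ in Bornology.cobounded ℂ ⊓ 𝓟 {z : ℂ | 0 < z.re},
      ‖f z‖ ≤ M * ‖z‖ ^ δ * Real.exp (d * z.im))
    -- the integrals on the right-hand sides exist
    (hg₁ : IntegrableOn
      (fun y : ℝ => besselK ν (ω * y) / ((y : ℂ) ^ 2 + (x : ℂ) ^ 2) * besselG 1 ν f x y)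
      (Ioi 0) volume)
    (hg₂ : IntegrableOn
      (fun y : ℝ => besselK ν (ω * y) / ((y : ℂ) ^ 2 + (x : ℂ) ^ 2) * besselG 2 ν f x y)
      (Ioi 0) volume) :
    (IntegrableAtFilter (fun t : ℝ => f t * besselJ ν (ω * t)) (𝓝[>] (0 : ℝ)) volume →
      HasPVIntegral (fun t : ℝ => f t / ((t : ℂ) - x) * besselJ ν (ω * t)) x
        (-Real.pi * f x * besselY ν (ω * x) -
          1 / Real.pi * ∫ y in Ioi (0 : ℝ),
            besselK ν (ω * y) / ((y : ℂ) ^ 2 + (x : ℂ) ^ 2) * besselG 1 ν f x y)) ∧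
    (IntegrableAtFilter (fun t : ℝ => f t * besselY ν (ω * t)) (𝓝[>] (0 : ℝ)) volume →
      HasPVIntegral (fun t : ℝ => f t / ((t : ℂ) - x) * besselY ν (ω * t)) x
        (Real.pi * f x * besselJ ν (ω * x) +
          I / Real.pi * ∫ y in Ioi (0 : ℝ),
            besselK ν (ω * y) / ((y : ℂ) ^ 2 + (x : ℂ) ^ 2) * besselG 2 ν f x y)) := by
  have hω : 0 < ω := hd.trans_lt hdω
  have hpi : (Real.pi : ℂ) ≠ 0 := by exact_mod_cast Real.pi_ne_zero
  simp_rw [besselG_one_eq, besselG_two_eq] at hg₁ hg₂ ⊢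
  have hA : IntegrableOn (axisUpper ν f ω x) (Ioi 0) := by
    refine ((hg₁.add hg₂).div_const 2).congr (ae_of_all _ fun y => ?_)
    simp only [Pi.add_apply]
    ring
  have hB : IntegrableOn (axisLower ν f ω x) (Ioi 0) := by
    refine ((hg₁.sub hg₂).div_const 2).congr (ae_of_all _ fun y => ?_)
    simp only [Pi.sub_apply]
    ring
  rw [integral_add hA hB, integral_sub hA hB]
  have hJ : ∀ t : ℝ, 0 < t → besselJ ν (ω * t) =
      1 / 2 * hankelOne ν (ω * t) + 1 / 2 * hankelTwo ν (ω * t) := fun t ht => by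
    have := hankelOne_add_hankelTwo ν (mul_pos hω ht)
    push_cast at this
    linear_combination (-1 / 2) * this
  have hY : ∀ t : ℝ, 0 < t → besselY ν (ω * t) =
      -I / 2 * hankelOne ν (ω * t) + I / 2 * hankelTwo ν (ω * t) := fun t ht => by
    have := hankelOne_sub_hankelTwo ν (mul_pos hω ht)
    push_cast at this
    linear_combination (I / 2) * this + besselY ν (ω * t) * I_sq
  constructor
  · intro h0
    convert hasPVIntegral_hankel hM hδ hd hdω hx hf hfc hf0 hgrowth hA hB hJ h0 using 1
    rw [hY x hx]
    field_simp
    ring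
  · intro h0
    convert hasPVIntegral_hankel hM hδ hd hdω hx hf hfc hf0 hgrowth hA hB hY h0 using 1
    rw [hJ x hx]
    field_simp
    linear_combination (Real.pi ^ 2 * f x * (hankelOne ν (ω * x) + hankelTwo ν (ω * x))) * I_sq
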